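/- An \emph{interlacing of $n$ lines} is a set of $n$ pairwise skew (that is, neither intersecting nor parallel) straight lines in Euclidean space $\mathbb R^3$. An \emph{isotopy} is a continuous motion of the lines during which they remain pairwise skew; two interlacings are \emph{isotopic} if there is an isotopy that carries the first set of lines onto the second. An interlacing is \emph{amphicheiral} if it is isotopic to its mirror image (its image under reflection in a plane). The \emph{linking number} of two oriented skew lines through points $p,q$ with direction vectors $v,w$ is the sign of $\det(p-q,v,w)$; the linking number $\mathrm{lk}(a,b,c)=\pm1$ of three pairwise skew lines is the product of the linking numbers of the three pairs for an arbitrary choice of orientations, on which it does not depend. A \emph{hyperboloid} is a one-sheeted hyperboloid, that is, the image of $x^2+y^2-z^2=1$ under an affine automorphism of $\mathbb R^3$; the region bounded by it is the image of $x^2+y^2-z^2\le 1$, and its axis is the image of the $z$-axis. For $\varepsilon=\pm1$ let $\langle\varepsilon4\rangle$ denote an interlacing of four generatrices of one hyperboloid such that all triples of these lines have linking number $\varepsilon$. Let $\langle\langle+2\rangle,\langle-2\rangle\rangle$ denote an interlacing $\{a,b,c,d\}$ for which there are two hyperboloids, bounding disjoint regions and having skew axes, such that $a,b$ are generatrices of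 the first, $c,d$ are generatrices of the second, $\mathrm{lk}(a,b,c)=\mathrm{lk}(a,b,d)=+1$ and $\mathrm{lk}(c,d,a)=\mathrm{lk}(c,d,b)=-1$. **Theorem.** There are exactly three isotopy classes of interlacings of four lines. Interlacings of each of the types $\langle+4\rangle$, $\langle-4\rangle$, $\langle\langle+2\rangle,\langle-2\rangle\rangle$ exist; all interlacings of the same type are isotopic to each other, those of different types are not isotopic, and every interlacing of four lines is isotopic to one of these. The classes of $\langle+4\rangle$ and $\langle-4\rangle$ are mirror images of each other, so their members are not amphicheiral; the mirror image of a member of the class of $\langle\langle+2\rangle,\langle-2\rangle\rangle$ is again in that class, i.e. its members are amphicheiral. -/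

import Mathlib

namespace SkewLines

/-- Euclidean three-space, with right-handed coordinates `x 0, x 1, x 2`. -/
abbrev Space : Type := EuclideanSpace ℝ (Fin 3)

/-- The line through `p` with direction vector `v` (a genuine line when `v ≠ 0`). -/
noncomputable def lineThrough (p v : Space) : AffineSubspace ℝ Space :=
  AffineSubspace.mk' p (Submodule.span ℝ {v})

/-- Two lines are skew: they have no common point and they are not parallel. -/
def Skew (l m : AffineSubspace ℝ Space) : Prop :=
  Disjoint (l : Set Space) (m : Set Space) ∧ ¬ AffineSubspace.Parallel l m

/-- An interlacing of `n` lines: a set of `n` pairwise skew lines in space. -/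
structure Interlacing (n : ℕ) where
  lines : Finset (AffineSubspace ℝ Space)
  card_lines : lines.card = n
  isLine : ∀ l ∈ lines, Module.finrank ℝ l.direction = 1
  skew : (lines : Set (AffineSubspace ℝ Space)).Pairwise Skew

/-- Two interlacings are isotopic: the lines of the first can be moved continuously (a moving
line being carried by a moving point and a moving nonzero direction vector), always remaining
pairwise skew, so that at the end they form the second set of lines. -/
def Isotopic {n : ℕ} (A B : Interlacing n) : Prop :=
  ∃ p v : unitInterval → Fin n → Space, Continuous p ∧ Continuous v ∧
    (∀ t i, v t i ≠ 0) ∧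
    (∀ t, Pairwise fun i j => Skew (lineThrough (p t i) (v t i)) (lineThrough (p t j) (v t j))) ∧
    Set.range (fun i => lineThrough (p 0 i) (v 0 i)) = A.lines ∧
    Set.range (fun i => lineThrough (p 1 i) (v 1 i)) = B.lines

/-! Isotopy is an equivalence relation. -/

theorem mem_lineThrough {p v x : Space} : x ∈ lineThrough p v ↔ ∃ s : ℝ, x = p + s • v := by
  rw [lineThrough, AffineSubspace.mem_mk', Submodule.mem_span_singleton]
  constructor
  · rintro ⟨s, hs⟩
    exact ⟨s, by rw [hs, vsub_eq_sub]; abel⟩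
  · rintro ⟨s, rfl⟩
    exact ⟨s, by rw [vsub_eq_sub]; abel⟩

theorem direction_lineThrough (p v : Space) :
    (lineThrough p v).direction = Submodule.span ℝ {v} := AffineSubspace.direction_mk' _ _

theorem lineThrough_add_smul (p v : Space) (s c : ℝ) (hc : c ≠ 0) :
    lineThrough (p + s • v) (c • v) = lineThrough p v := by
  ext x
  simp only [mem_lineThrough]
  constructor
  · rintro ⟨t, rfl⟩
    exact ⟨s + t * c, by rw [add_smul, smul_smul, add_assoc]⟩
  · rintro ⟨t, rfl⟩
    refine ⟨(t - s) / c, ?_⟩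
    rw [smul_smul, div_mul_cancel₀ _ hc, sub_smul]; abel

theorem exists_of_lineThrough_eq {p v q w : Space} (hw : w ≠ 0)
    (h : lineThrough p v = lineThrough q w) :
    ∃ s c : ℝ, c ≠ 0 ∧ q = p + s • v ∧ w = c • v := by
  have hq : q ∈ lineThrough p v := by
    rw [h]; exact mem_lineThrough.2 ⟨0, by simp⟩
  obtain ⟨s, hs⟩ := mem_lineThrough.1 hq
  have hd : w ∈ Submodule.span ℝ {v} := by
    rw [← direction_lineThrough p v, h, direction_lineThrough]
    exact Submodule.mem_span_singleton_self w
  obtain ⟨c, hc⟩ := Submodule.mem_span_singleton.1 hd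
  refine ⟨s, c, ?_, hs, hc.symm⟩
  rintro rfl
  exact hw (by rw [← hc, zero_smul])

theorem not_skew_lineThrough_self (p v : Space) : ¬ Skew (lineThrough p v) (lineThrough p v) := by
  rintro ⟨-, h⟩
  exact h (AffineSubspace.Parallel.refl _)

theorem exists_lineThrough {l : AffineSubspace ℝ Space} (hl : Module.finrank ℝ l.direction = 1) :
    ∃ p v : Space, v ≠ 0 ∧ lineThrough p v = l := by
  have hne : (l : Set Space).Nonempty := by
    rcases l.eq_bot_or_nonempty with rfl | h
    · rw [AffineSubspace.direction_bot, finrank_bot] at hl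
      exact absurd hl zero_ne_one
    · exact h
  obtain ⟨p, hp⟩ := hne
  obtain ⟨v, hv, hspan⟩ := finrank_eq_one_iff'.1 hl
  refine ⟨p, v, fun h => hv (Subtype.ext h), ?_⟩
  have hs : Submodule.span ℝ {(v : Space)} = l.direction := by
    apply le_antisymm
    · rw [Submodule.span_singleton_le_iff_mem]; exact v.2
    · intro w hw
      obtain ⟨c, hc⟩ := hspan ⟨w, hw⟩
      exact Submodule.mem_span_singleton.2 ⟨c, congrArg Subtype.val hc⟩
  rw [lineThrough, hs]
  exact AffineSubspace.mk'_eq hp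

/-- Tuples of points and nonzero direction vectors of pairwise skew lines. -/
def frames (n : ℕ) : Set ((Fin n → Space) × (Fin n → Space)) :=
  {x | (∀ i, x.2 i ≠ 0) ∧
    Pairwise fun i j => Skew (lineThrough (x.1 i) (x.2 i)) (lineThrough (x.1 j) (x.2 j))}

/-- The set of lines of a frame. -/
def frameLines {n : ℕ} (x : (Fin n → Space) × (Fin n → Space)) : Set (AffineSubspace ℝ Space) :=
  Set.range fun i => lineThrough (x.1 i) (x.2 i)

theorem isotopic_iff {n : ℕ} (A B : Interlacing n) :
    Isotopic A B ↔ ∃ x y, JoinedIn (frames n) x y ∧ frameLines x = A.lines ∧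
      frameLines y = B.lines := by
  constructor
  · rintro ⟨p, v, hp, hv, h0, hs, hA, hB⟩
    exact ⟨(p 0, v 0), (p 1, v 1),
      ⟨⟨⟨fun t => (p t, v t), hp.prodMk hv⟩, rfl, rfl⟩, fun t => ⟨h0 t, hs t⟩⟩, hA, hB⟩
  · rintro ⟨x, y, ⟨γ, hγ⟩, hA, hB⟩
    refine ⟨fun t => (γ t).1, fun t => (γ t).2, by fun_prop, by fun_prop,
      fun t => (hγ t).1, fun t => (hγ t).2, ?_, ?_⟩
    · simpa only [γ.source, frameLines] using hA
    · simpa only [γ.target, frameLines] using hB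

theorem frames_injective {n : ℕ} {x : (Fin n → Space) × (Fin n → Space)} (hx : x ∈ frames n) :
    Function.Injective fun i => lineThrough (x.1 i) (x.2 i) := by
  intro i j h
  by_contra hij
  have h2 := hx.2 hij
  dsimp only at h h2
  rw [← h] at h2
  exact not_skew_lineThrough_self _ _ h2

theorem exists_frame {n : ℕ} (A : Interlacing n) : ∃ x ∈ frames n, frameLines x = A.lines := by
  let e := A.lines.equivFinOfCardEq A.card_lines
  choose p v hv hl using fun i : Fin n => exists_lineThrough (A.isLine _ (e.symm i).2)
  refine ⟨(p, v), ⟨hv, fun i j hij => ?_⟩, ?_⟩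
  · simp only [hl]
    exact A.skew (e.symm i).2 (e.symm j).2 fun h => hij (e.symm.injective (Subtype.ext h))
  · ext l
    simp only [frameLines, hl, Set.mem_range]
    constructor
    · rintro ⟨i, rfl⟩
      exact (e.symm i).2
    · intro h
      exact ⟨e ⟨l, h⟩, by simp⟩

theorem joinedIn_of_lines_eq {n : ℕ} {x y : (Fin n → Space) × (Fin n → Space)}
    (hx : x ∈ frames n) (s c : Fin n → ℝ) (hc : ∀ i, 0 < c i)
    (h1 : ∀ i, y.1 i = x.1 i + s i • x.2 i) (h2 : ∀ i, y.2 i = c i • x.2 i) :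
    JoinedIn (frames n) x y := by
  let F : unitInterval → (Fin n → Space) × (Fin n → Space) := fun t =>
    (fun i => x.1 i + ((t : ℝ) * s i) • x.2 i, fun i => (1 - (t : ℝ) + t * c i) • x.2 i)
  have hF : Continuous F := by
    apply Continuous.prodMk <;> refine continuous_pi fun i => ?_ <;> fun_prop
  have hpos : ∀ (t : unitInterval) i, 0 < 1 - (t : ℝ) + t * c i := by
    intro t i
    rcases t.2.1.eq_or_lt with h | h
    · rw [← h]; norm_num
    · have := mul_pos h (hc i)
      have := t.2.2
      linarith
  refine ⟨⟨⟨F, hF⟩, ?_, ?_⟩, fun t => ⟨fun i => smul_ne_zero (hpos t i).ne' (hx.1 i), ?_⟩⟩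
  · simp [F]
  · refine Prod.ext (funext fun i => ?_) (funext fun i => ?_)
    · simp [F, h1]
    · simp [F, h2]
  · intro i j hij
    have key : ∀ k, lineThrough ((F t).1 k) ((F t).2 k) = lineThrough (x.1 k) (x.2 k) :=
      fun k => lineThrough_add_smul _ _ _ _ (hpos t k).ne'
    have := hx.2 hij
    simp only at this
    rw [← key i, ← key j] at this
    exact this

theorem isotopic_equivalence (n : ℕ) : Equivalence (Isotopic (n := n)) where
  refl A := by
    obtain ⟨x, hx, h⟩ := exists_frame A
    exact (isotopic_iff A A).2 ⟨x, x, JoinedIn.refl hx, h, h⟩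
  symm {A B} h := by
    obtain ⟨x, y, hxy, hA, hB⟩ := (isotopic_iff A B).1 h
    exact (isotopic_iff B A).2 ⟨y, x, hxy.symm, hB, hA⟩
  trans {A B C} hAB hBC := by
    obtain ⟨x, y, hxy, hA, hB⟩ := (isotopic_iff A B).1 hAB
    obtain ⟨z, w, hzw, hB', hC⟩ := (isotopic_iff B C).1 hBC
    have hy := hxy.target_mem
    have hz := hzw.source_mem
    have hr : frameLines y = frameLines z := hB.trans hB'.symm
    have hex : ∀ i, ∃ j, lineThrough (z.1 j) (z.2 j) = lineThrough (y.1 i) (y.2 i) := by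
      intro i
      have : lineThrough (y.1 i) (y.2 i) ∈ frameLines z := hr ▸ ⟨i, rfl⟩
      exact this
    choose f hf using hex
    have hfi : Function.Injective f := by
      intro i j hij
      apply frames_injective hy
      simp only
      rw [← hf i, ← hf j, hij]
    let σ : Fin n ≃ Fin n := Equiv.ofBijective f (Finite.injective_iff_bijective.1 hfi)
    choose s c hc hs hcv using fun i => exists_of_lineThrough_eq (hz.1 (f i)) (hf i).symm
    let e : Fin n → ℝ := fun i => SignType.sign (c i)
    have he : ∀ i, e i ≠ 0 := by
      intro i
      rcases lt_or_gt_of_ne (hc i) with h | h <;> simp [e, h]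
    let T : (Fin n → Space) × (Fin n → Space) → (Fin n → Space) × (Fin n → Space) :=
      fun u => (fun i => u.1 (f i), fun i => e i • u.2 (f i))
    have hT : Continuous T := by fun_prop
    have hline : ∀ u i, lineThrough ((T u).1 i) ((T u).2 i) =
        lineThrough (u.1 (f i)) (u.2 (f i)) := by
      intro u i
      simpa using lineThrough_add_smul (u.1 (f i)) (u.2 (f i)) 0 (e i) (he i)
    have hTmem : T '' frames n ⊆ frames n := by
      rintro _ ⟨u, hu, rfl⟩
      refine ⟨fun i => smul_ne_zero (he i) (hu.1 _), fun i j hij => ?_⟩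
      have := hu.2 (hfi.ne hij)
      simp only at this ⊢
      rw [hline, hline]
      exact this
    have hTw : frameLines (T w) = C.lines := by
      rw [← hC, frameLines]
      simp only [hline]
      exact (σ.surjective.range_comp fun j => lineThrough (w.1 j) (w.2 j))
    refine (isotopic_iff A C).2 ⟨x, T w, ?_, hA, hTw⟩
    have hyT : JoinedIn (frames n) y (T z) := by
      refine joinedIn_of_lines_eq hy s (fun i => |c i|) (fun i => abs_pos.2 (hc i)) hs
        fun i => ?_
      simp only [T, hcv i, smul_smul, e, sign_mul_self]
    obtain ⟨γ, hγ⟩ := hzw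
    have hTT : JoinedIn (frames n) (T z) (T w) :=
      ⟨γ.map hT, fun t => hTmem ⟨γ t, hγ t, rfl⟩⟩
    exact (hxy.trans hyT).trans hTT

/-- The isotopy relation. -/
def isotopySetoid (n : ℕ) : Setoid (Interlacing n) := ⟨Isotopic, isotopic_equivalence n⟩

/-- Isotopy classes of interlacings of `n` lines. -/
def IsotopyClass (n : ℕ) : Type := Quotient (isotopySetoid n)

/-- The isotopy class of an interlacing. -/
def Interlacing.isotopyClass {n : ℕ} (A : Interlacing n) : IsotopyClass n :=
  Quotient.mk (isotopySetoid n) A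

/-! Mirror images. -/

theorem skew_map (f : Space ≃ᵃ[ℝ] Space) {l m : AffineSubspace ℝ Space} (h : Skew l m) :
    Skew (l.map f.toAffineMap) (m.map f.toAffineMap) := by
  refine ⟨?_, fun hp => h.2 ?_⟩
  · rw [AffineSubspace.coe_map, AffineSubspace.coe_map]
    exact (Set.disjoint_image_iff f.injective).2 h.1
  · rw [AffineSubspace.parallel_iff_direction_eq_and_eq_bot_iff_eq_bot] at hp ⊢
    simp only [AffineSubspace.map_direction, AffineSubspace.map_eq_bot_iff] at hp
    exact ⟨Submodule.map_injective_of_injective f.linear.injective hp.1, hp.2⟩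

/-- The image of an interlacing under an affine automorphism of space. -/
noncomputable def Interlacing.map {n : ℕ} (f : Space ≃ᵃ[ℝ] Space) (A : Interlacing n) : Interlacing n where
  lines := A.lines.map ⟨AffineSubspace.map f.toAffineMap,
    fun l m h => SetLike.coe_injective (f.injective.image_injective (by
      simpa only [AffineSubspace.coe_map, AffineEquiv.coe_toAffineMap] using
        congrArg (fun s : AffineSubspace ℝ Space => (s : Set Space)) h))⟩
  card_lines := by rw [Finset.card_map, A.card_lines]
  isLine := by
    intro l hl
    obtain ⟨m, hm, rfl⟩ := Finset.mem_map.1 hl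
    change Module.finrank ℝ (m.map f.toAffineMap).direction = 1
    rw [AffineSubspace.map_direction]
    exact (LinearEquiv.finrank_map_eq f.linear m.direction).trans (A.isLine m hm)
  skew := by
    intro l hl l' hl' hne
    obtain ⟨m, hm, rfl⟩ := Finset.mem_map.1 (Finset.mem_coe.1 hl)
    obtain ⟨m', hm', rfl⟩ := Finset.mem_map.1 (Finset.mem_coe.1 hl')
    exact skew_map f (A.skew hm hm' fun h => hne (by rw [h]))

/-- The mirror image of an interlacing in the plane `P` (used when `P` has dimension two). -/
noncomputable def Interlacing.mirror {n : ℕ} (P : AffineSubspace ℝ Space) [Nonempty P]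
    (A : Interlacing n) : Interlacing n :=
  A.map (EuclideanGeometry.reflection P).toAffineEquiv

/-- An interlacing is amphicheiral if it is isotopic to its mirror image in some plane
(equivalently, in any plane). -/
def Amphicheiral {n : ℕ} (A : Interlacing n) : Prop :=
  ∃ (P : AffineSubspace ℝ Space) (_ : Nonempty P), Module.finrank ℝ P.direction = 2 ∧
    Isotopic A (A.mirror P)

/-! Linking numbers. -/

/-- The linking number of two oriented skew lines, given by points `p`, `q` and direction vectors
`v`, `w`: the sign of the determinant with rows `p - q`, `v`, `w`.  For example, it is `+1` for the
axis `ℝ e₂`, oriented by `e₂`, and the line `e₀ + ℝ e₁`, oriented by `e₁`, i.e. when the second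
line runs around the first one in the direction of the fingers of the right hand whose thumb
points along the first line. -/
noncomputable def pairLinking (p v q w : Space) : SignType :=
  SignType.sign (Matrix.det !![p 0 - q 0, p 1 - q 1, p 2 - q 2; v 0, v 1, v 2; w 0, w 1, w 2])

/-- `ε` is the linking number of the triple of lines `l`, `m`, `k`: the product of the three
pairwise linking numbers, for some (equivalently, any) orientations of the lines. -/
def TripleLinking (l m k : AffineSubspace ℝ Space) (ε : SignType) : Prop :=
  ∃ p v q w r u : Space, v ≠ 0 ∧ w ≠ 0 ∧ u ≠ 0 ∧
    lineThrough p v = l ∧ lineThrough q w = m ∧ lineThrough r u = k ∧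
    pairLinking p v q w * pairLinking q w r u * pairLinking p v r u = ε

/-! One-sheeted hyperboloids are the images of `x₀² + x₁² - x₂² = 1` under the affine
automorphisms `f` of space. -/

/-- The one-sheeted hyperboloid given by `f`. -/
def hyperboloid (f : Space ≃ᵃ[ℝ] Space) : Set Space :=
  f '' {x | x 0 ^ 2 + x 1 ^ 2 - x 2 ^ 2 = 1}

/-- The closed region, containing the axis, that is bounded by the hyperboloid. -/
def hyperboloidRegion (f : Space ≃ᵃ[ℝ] Space) : Set Space :=
  f '' {x | x 0 ^ 2 + x 1 ^ 2 - x 2 ^ 2 ≤ 1}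

/-- The axis of the hyperboloid. -/
noncomputable def hyperboloidAxis (f : Space ≃ᵃ[ℝ] Space) : AffineSubspace ℝ Space :=
  (lineThrough 0 (EuclideanSpace.single 2 1)).map f.toAffineMap

/-- Interlacings `⟨ε n⟩`: all the lines are generatrices of one hyperboloid (being pairwise skew,
they are generatrices of the same family), and all triples of them have linking number `ε`. -/
def IsHyperboloidal (ε : SignType) {n : ℕ} (A : Interlacing n) : Prop :=
  (∃ f : Space ≃ᵃ[ℝ] Space, ∀ l ∈ A.lines, (l : Set Space) ⊆ hyperboloid f) ∧
  ∀ l ∈ A.lines, ∀ m ∈ A.lines, ∀ k ∈ A.lines, l ≠ m → l ≠ k → m ≠ k → TripleLinking l m k ε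

/-- Interlacings `⟨⟨ε 2⟩, ⟨δ 2⟩⟩`: there are two hyperboloids which bound disjoint regions and have
skew axes; two of the lines, `a` and `b`, are generatrices of the first hyperboloid, the other two,
`c` and `d`, are generatrices of the second one; the linking number of the triple `a, b, x` is `ε`
for each other line `x`, and that of `c, d, x` is `δ` for each other line `x`. -/
def IsPairOfPairs (ε δ : SignType) (A : Interlacing 4) : Prop :=
  ∃ f g : Space ≃ᵃ[ℝ] Space,
    Disjoint (hyperboloidRegion f) (hyperboloidRegion g) ∧
    Skew (hyperboloidAxis f) (hyperboloidAxis g) ∧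
    ∃ a b c d : AffineSubspace ℝ Space,
      (A.lines : Set (AffineSubspace ℝ Space)) = {a, b, c, d} ∧
      (a : Set Space) ⊆ hyperboloid f ∧ (b : Set Space) ⊆ hyperboloid f ∧
      (c : Set Space) ⊆ hyperboloid g ∧ (d : Set Space) ⊆ hyperboloid g ∧
      TripleLinking a b c ε ∧ TripleLinking a b d ε ∧
      TripleLinking c d a δ ∧ TripleLinking c d b δ

end SkewLines

open SkewLines

/-!
The linking numbers of the triples of lines do not change under isotopy, since the determinants that
define them do not vanish along it. Each pair of four lines lies in two triples, so the product of
the four linking numbers is `1`, and the triples are all positive, all negative, or two of each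
sign. It remains to see that interlacings of the same kind are isotopic.

In homogeneous coordinates a line is a plane in `ℝ⁴`, and two lines of affine space are skew exactly
when their planes are complementary. Taking the planes of the first two lines as `ℝ² ⊕ 0` and
`0 ⊕ ℝ²` and scaling so that the third one is the diagonal, the fourth one becomes the graph of a
`2 × 2` matrix `M` with `det M ≠ 0` and `det (M - 1) ≠ 0` (`exists_chart`). So four lines are given
by the matrix `g` of the coordinate change together with `M`, and the linking numbers of the triples
are read off from the signs of `det g`, `det M` and `det (M - 1)` (`tripleSign_chartFrame`).

The last row of `g` is the equation of the plane at infinity. For a fixed `M` this plane can be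
moved to any generic position by a pencil of planes none of which contains one of the four lines
(`joinedIn_change_infinity`). Coordinate changes of the same orientation with the same plane at
infinity differ by an affine map of positive determinant, which is connected to the identity
(`joinedIn_affine`). Hence `g` is irrelevant except for the sign of its determinant. Once the plane
at infinity is close to the second line, a path of matrices `M` is a motion of the fourth line
(`joinedIn_charts`), and only the components of the set of matrices `M` matter.

If `det M` and `det (M - 1)` are positive, the eigenvalues of `M` are complex or lie in the same
component of `ℝ ∖ {0, 1}`, and `M` is connected to `-1` (`joinedIn_neg_one`); this is the case of
equal linking numbers. Otherwise, after a renumbering of the lines, `det M > 0 > det (M - 1)`, the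
eigenvalues are separated by `1`, and a common basis change in the two summands, which moves no
line, makes `M` diagonal; these diagonal matrices form a convex set (`isotopic_of_not_isUniform`).

A reflection reverses all linking numbers of triples, which gives the statements on mirror images.
-/

namespace SkewLines

/-! ### Skewness and linking numbers as determinants -/

/-- The determinant whose sign is the linking number of the oriented lines `p + ℝ v`, `q + ℝ w`. -/
noncomputable def linkDet (p v q w : Space) : ℝ :=
  Matrix.det !![p 0 - q 0, p 1 - q 1, p 2 - q 2; v 0, v 1, v 2; w 0, w 1, w 2]

theorem pairLinking_eq_sign (p v q w : Space) :
    pairLinking p v q w = SignType.sign (linkDet p v q w) := rfl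

theorem linkDet_eq (p v q w : Space) :
    linkDet p v q w = (p 0 - q 0) * (v 1 * w 2 - v 2 * w 1) - (p 1 - q 1) * (v 0 * w 2 - v 2 * w 0)
      + (p 2 - q 2) * (v 0 * w 1 - v 1 * w 0) := by
  simp [linkDet, Matrix.det_fin_three]; ring

theorem linkDet_comm (p v q w : Space) : linkDet q w p v = linkDet p v q w := by
  simp only [linkDet_eq]; ring

theorem linkDet_add_smul (p v q w : Space) (s c t d : ℝ) :
    linkDet (p + s • v) (c • v) (q + t • w) (d • w) = c * d * linkDet p v q w := by
  simp only [linkDet_eq, PiLp.add_apply, PiLp.smul_apply, smul_eq_mul]; ring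

theorem continuous_linkDet :
    Continuous fun x : (Space × Space) × (Space × Space) => linkDet x.1.1 x.1.2 x.2.1 x.2.2 := by
  simp only [linkDet_eq]
  fun_prop

/-- The linking determinant as the value of the determinant form of the standard basis. -/
theorem linkDet_eq_basis_det (p v q w : Space) :
    linkDet p v q w = (EuclideanSpace.basisFun (Fin 3) ℝ).toBasis.det ![p - q, v, w] := by
  rw [linkDet, Module.Basis.det_apply, ← Matrix.det_transpose]
  congr 1
  ext i j
  fin_cases i <;> fin_cases j <;> simp [Module.Basis.toMatrix_apply]

theorem linkDet_map (f : Space ≃ᵃ[ℝ] Space) (p v q w : Space) :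
    linkDet (f p) (f.linear v) (f q) (f.linear w) =
      LinearMap.det (f.linear : Space →ₗ[ℝ] Space) * linkDet p v q w := by
  rw [linkDet_eq_basis_det, linkDet_eq_basis_det, ← Module.Basis.det_comp]
  congr 1
  ext i
  fin_cases i <;> simp
  have := f.map_vadd q (p - q)
  simp only [vadd_eq_add, sub_add_cancel] at this
  rw [this]; simp

theorem parallel_lineThrough_iff (p v q w : Space) :
    (lineThrough p v).Parallel (lineThrough q w) ↔
      Submodule.span ℝ {v} = Submodule.span ℝ {w} := by
  rw [AffineSubspace.parallel_iff_direction_eq_and_eq_bot_iff_eq_bot, direction_lineThrough,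
    direction_lineThrough, and_iff_left]
  have key : ∀ p v : Space, lineThrough p v ≠ ⊥ := fun p v h => by
    have : p ∈ lineThrough p v := mem_lineThrough.2 ⟨0, by simp⟩
    rw [h] at this
    exact AffineSubspace.notMem_bot ℝ Space p this
  exact iff_of_false (key p v) (key q w)

theorem skew_lineThrough_iff {p v q w : Space} (hv : v ≠ 0) (hw : w ≠ 0) :
    Skew (lineThrough p v) (lineThrough q w) ↔ linkDet p v q w ≠ 0 := by
  constructor
  · rintro ⟨hd, hp⟩ h0
    obtain ⟨a, ha, hM⟩ := Matrix.exists_vecMul_eq_zero_iff.2 h0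
    have hM' : a 0 • (p - q) + a 1 • v + a 2 • w = 0 := by
      ext k
      have := congrFun hM k
      fin_cases k <;> simpa [Matrix.vecMul, dotProduct, Fin.sum_univ_three] using this
    by_cases h : a 0 = 0
    · rw [h, zero_smul, zero_add] at hM'
      have h1 : a 1 ≠ 0 := by
        intro h1
        rw [h1, zero_smul, zero_add, smul_eq_zero] at hM'
        refine ha (funext fun k => ?_)
        fin_cases k
        exacts [h, h1, hM'.resolve_right hw]
      have h2 : a 2 ≠ 0 := by
        intro h2
        rw [h2, zero_smul, add_zero, smul_eq_zero] at hM'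
        exact hM'.elim h1 hv
      refine hp ((parallel_lineThrough_iff _ _ _ _).2 ?_)
      have : w = (-(a 2)⁻¹ * a 1) • v := by
        rw [mul_smul, eq_neg_of_add_eq_zero_left hM', smul_neg, neg_smul, neg_neg, smul_smul,
          inv_mul_cancel₀ h2, one_smul]
      rw [this, Submodule.span_singleton_smul_eq]
      exact (mul_ne_zero (neg_ne_zero.2 (inv_ne_zero h2)) h1).isUnit
    · refine Set.disjoint_left.1 hd (mem_lineThrough.2 ⟨(a 0)⁻¹ * a 1, rfl⟩)
        (mem_lineThrough.2 ⟨-((a 0)⁻¹ * a 2), ?_⟩)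
      have := congrArg (fun x => q + (a 0)⁻¹ • x) hM'
      simp only [smul_add, smul_smul, inv_mul_cancel₀ h, one_smul, smul_zero, add_zero] at this
      rw [neg_smul, ← sub_eq_add_neg, eq_sub_iff_add_eq, ← this]
      abel
  · refine fun h => ⟨Set.disjoint_left.2 fun x hx hx' => h ?_, fun hp => h ?_⟩
    · obtain ⟨s, rfl⟩ := mem_lineThrough.1 hx
      obtain ⟨t, ht⟩ := mem_lineThrough.1 hx'
      have e : ∀ k, p k = q k + t * w k - s * v k := fun k => by
        have := congrArg (fun x : Space => x k) ht
        simp only [PiLp.add_apply, PiLp.smul_apply, smul_eq_mul] at this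
        linarith
      simp only [linkDet_eq, e]; ring
    · rw [parallel_lineThrough_iff] at hp
      obtain ⟨c, rfl⟩ := Submodule.mem_span_singleton.1 (hp ▸ Submodule.mem_span_singleton_self w)
      simp only [linkDet_eq, PiLp.smul_apply, smul_eq_mul]; ring

theorem ne_zero_of_linkDet_ne_zero {p v q w : Space} (h : linkDet p v q w ≠ 0) : v ≠ 0 := by
  rintro rfl
  exact h (by simp [linkDet_eq])

/-- The linking number of a triple of lines does not depend on the choice of orientations. -/
theorem TripleLinking.unique {l m k : AffineSubspace ℝ Space} {ε δ : SignType}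
    (h : TripleLinking l m k ε) (h' : TripleLinking l m k δ) : ε = δ := by
  obtain ⟨p, v, q, w, r, u, hv, hw, hu, rfl, rfl, rfl, rfl⟩ := h
  obtain ⟨p', v', q', w', r', u', hv', hw', hu', hl, hm, hk, rfl⟩ := h'
  obtain ⟨s, c, hc, rfl, rfl⟩ := exists_of_lineThrough_eq hv' hl.symm
  obtain ⟨t, d, hd, rfl, rfl⟩ := exists_of_lineThrough_eq hw' hm.symm
  obtain ⟨z, e, he, rfl, rfl⟩ := exists_of_lineThrough_eq hu' hk.symm
  simp only [pairLinking_eq_sign, ← sign_mul, linkDet_add_smul]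
  rw [show c * d * linkDet p v q w * (d * e * linkDet q w r u) * (c * e * linkDet p v r u) =
    (c * d * e) ^ 2 * (linkDet p v q w * linkDet q w r u * linkDet p v r u) by ring,
    sign_mul ((c * d * e) ^ 2),
    sign_pos (sq_pos_iff.2 (mul_ne_zero (mul_ne_zero hc hd) he)), one_mul]

theorem lineThrough_map (f : Space ≃ᵃ[ℝ] Space) (p v : Space) :
    (lineThrough p v).map f.toAffineMap = lineThrough (f p) (f.linear v) := by
  rw [lineThrough, AffineSubspace.map_mk', lineThrough, Submodule.map_span, Set.image_singleton]
  rfl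

theorem TripleLinking.map_neg {l m k : AffineSubspace ℝ Space} {ε : SignType}
    (h : TripleLinking l m k ε) (f : Space ≃ᵃ[ℝ] Space)
    (hf : LinearMap.det (f.linear : Space →ₗ[ℝ] Space) = -1) :
    TripleLinking (l.map f.toAffineMap) (m.map f.toAffineMap) (k.map f.toAffineMap) (-ε) := by
  obtain ⟨p, v, q, w, r, u, hv, hw, hu, rfl, rfl, rfl, rfl⟩ := h
  refine ⟨f p, f.linear v, f q, f.linear w, f r, f.linear u, by simpa, by simpa, by simpa,
    (lineThrough_map ..).symm, (lineThrough_map ..).symm, (lineThrough_map ..).symm, ?_⟩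
  simp only [pairLinking_eq_sign, ← sign_mul, linkDet_map, hf, ← Left.sign_neg]
  congr 1
  ring

/-! ### Linking numbers of triples are isotopy invariants -/

/-- The interlacing formed by the lines of a frame. -/
noncomputable def Interlacing.ofFrame {n : ℕ} (x : (Fin n → Space) × (Fin n → Space))
    (hx : x ∈ frames n) : Interlacing n where
  lines := Finset.univ.map ⟨_, frames_injective hx⟩
  card_lines := by simp
  isLine := by
    intro l hl
    obtain ⟨i, -, rfl⟩ := Finset.mem_map.1 hl
    change Module.finrank ℝ (lineThrough (x.1 i) (x.2 i)).direction = 1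
    rw [direction_lineThrough]
    exact finrank_span_singleton (hx.1 i)
  skew := by
    intro l hl m hm hne
    obtain ⟨i, -, rfl⟩ := Finset.mem_map.1 (Finset.mem_coe.1 hl)
    obtain ⟨j, -, rfl⟩ := Finset.mem_map.1 (Finset.mem_coe.1 hm)
    exact hx.2 fun h => hne (by rw [h])

theorem Interlacing.coe_lines_ofFrame {n : ℕ} (x : (Fin n → Space) × (Fin n → Space))
    (hx : x ∈ frames n) : ((Interlacing.ofFrame x hx).lines : Set _) = frameLines x := by
  ext l
  simp [Interlacing.ofFrame, frameLines]

/-- The linking number of the lines of a frame with indices `i`, `j`, `k`. -/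
noncomputable def tripleSign {n : ℕ} (x : (Fin n → Space) × (Fin n → Space)) (i j k : Fin n) :
    SignType :=
  pairLinking (x.1 i) (x.2 i) (x.1 j) (x.2 j) * pairLinking (x.1 j) (x.2 j) (x.1 k) (x.2 k) *
    pairLinking (x.1 i) (x.2 i) (x.1 k) (x.2 k)

theorem tripleLinking_tripleSign {n : ℕ} {x : (Fin n → Space) × (Fin n → Space)}
    (hx : x ∈ frames n) (i j k : Fin n) :
    TripleLinking (lineThrough (x.1 i) (x.2 i)) (lineThrough (x.1 j) (x.2 j))
      (lineThrough (x.1 k) (x.2 k)) (tripleSign x i j k) :=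
  ⟨_, _, _, _, _, _, hx.1 i, hx.1 j, hx.1 k, rfl, rfl, rfl, rfl⟩

theorem linkDet_ne_zero_of_mem_frames {n : ℕ} {x : (Fin n → Space) × (Fin n → Space)}
    (hx : x ∈ frames n) {i j : Fin n} (hij : i ≠ j) :
    linkDet (x.1 i) (x.2 i) (x.1 j) (x.2 j) ≠ 0 :=
  (skew_lineThrough_iff (hx.1 i) (hx.1 j)).1 (hx.2 hij)

theorem mem_frames_iff {n : ℕ} [Nontrivial (Fin n)] {x : (Fin n → Space) × (Fin n → Space)} :
    x ∈ frames n ↔ Pairwise fun i j => linkDet (x.1 i) (x.2 i) (x.1 j) (x.2 j) ≠ 0 := by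
  refine ⟨fun hx i j hij => linkDet_ne_zero_of_mem_frames hx hij, fun h => ?_⟩
  have hv : ∀ i, x.2 i ≠ 0 := fun i => by
    obtain ⟨j, hj⟩ := exists_ne i
    exact ne_zero_of_linkDet_ne_zero (h hj.symm)
  exact ⟨hv, fun i j hij => (skew_lineThrough_iff (hv i) (hv j)).2 (h hij)⟩

theorem sign_eq_of_continuous {X : Type*} [TopologicalSpace X] [PreconnectedSpace X] {f : X → ℝ}
    (hf : Continuous f) (h0 : ∀ t, f t ≠ 0) (a b : X) :
    SignType.sign (f a) = SignType.sign (f b) := by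
  have hc : Continuous fun t => SignType.sign (f t) :=
    continuous_iff_continuousAt.2 fun t =>
      ContinuousAt.comp (continuousAt_sign_of_ne_zero (h0 t)) hf.continuousAt
  exact PreconnectedSpace.constant inferInstance hc

theorem tripleSign_eq_of_joinedIn {n : ℕ} {x y : (Fin n → Space) × (Fin n → Space)}
    (h : JoinedIn (frames n) x y) {i j k : Fin n} (hij : i ≠ j) (hjk : j ≠ k) (hik : i ≠ k) :
    tripleSign x i j k = tripleSign y i j k := by
  obtain ⟨γ, hγ⟩ := h
  have key : ∀ {i j : Fin n}, i ≠ j → pairLinking (x.1 i) (x.2 i) (x.1 j) (x.2 j) =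
      pairLinking (y.1 i) (y.2 i) (y.1 j) (y.2 j) := by
    intro i j hij
    have hc : Continuous fun t : unitInterval =>
        linkDet ((γ t).1 i) ((γ t).2 i) ((γ t).1 j) ((γ t).2 j) :=
      continuous_linkDet.comp (g := fun x : (Space × Space) × (Space × Space) =>
          linkDet x.1.1 x.1.2 x.2.1 x.2.2)
        (f := fun t : unitInterval => (((γ t).1 i, (γ t).2 i), ((γ t).1 j, (γ t).2 j)))
        (by fun_prop)
    simpa [pairLinking_eq_sign] using
      sign_eq_of_continuous hc (fun t => linkDet_ne_zero_of_mem_frames (hγ t) hij) 0 1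
  simp only [tripleSign, key hij, key hjk, key hik]

/-- All triples of lines of the interlacing have linking number `ε`. -/
def Interlacing.IsUniform (ε : SignType) {n : ℕ} (A : Interlacing n) : Prop :=
  ∀ l ∈ A.lines, ∀ m ∈ A.lines, ∀ k ∈ A.lines, l ≠ m → l ≠ k → m ≠ k → TripleLinking l m k ε

theorem isUniform_iff {n : ℕ} {A : Interlacing n} {x : (Fin n → Space) × (Fin n → Space)}
    (hx : x ∈ frames n) (hA : frameLines x = A.lines) (ε : SignType) :
    A.IsUniform ε ↔ ∀ i j k, i ≠ j → j ≠ k → i ≠ k → tripleSign x i j k = ε := by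
  have mem : ∀ l, l ∈ A.lines ↔ ∃ i, lineThrough (x.1 i) (x.2 i) = l := fun l => by
    rw [← Finset.mem_coe, ← hA]; rfl
  constructor
  · intro h i j k hij hjk hik
    exact (tripleLinking_tripleSign hx i j k).unique
      (h _ ((mem _).2 ⟨i, rfl⟩) _ ((mem _).2 ⟨j, rfl⟩) _ ((mem _).2 ⟨k, rfl⟩)
        ((frames_injective hx).ne hij) ((frames_injective hx).ne hik)
        ((frames_injective hx).ne hjk))
  · intro h l hl m hm k hk hlm hlk hmk
    obtain ⟨i, rfl⟩ := (mem _).1 hl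
    obtain ⟨j, rfl⟩ := (mem _).1 hm
    obtain ⟨k, rfl⟩ := (mem _).1 hk
    rw [← h i j k (fun e => hlm (by rw [e])) (fun e => hmk (by rw [e])) (fun e => hlk (by rw [e]))]
    exact tripleLinking_tripleSign hx i j k

theorem Isotopic.isUniform_iff {n : ℕ} {A B : Interlacing n} (h : Isotopic A B) (ε : SignType) :
    A.IsUniform ε ↔ B.IsUniform ε := by
  obtain ⟨x, y, hxy, hA, hB⟩ := (isotopic_iff A B).1 h
  rw [SkewLines.isUniform_iff hxy.source_mem hA, SkewLines.isUniform_iff hxy.target_mem hB]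
  refine forall_congr' fun i => forall_congr' fun j => forall_congr' fun k =>
    forall_congr' fun hij => forall_congr' fun hjk => forall_congr' fun hik => ?_
  rw [tripleSign_eq_of_joinedIn hxy hij hjk hik]

theorem det_linear_reflection (P : AffineSubspace ℝ Space) [Nonempty P]
    (hP : Module.finrank ℝ P.direction = 2) :
    LinearMap.det ((EuclideanGeometry.reflection P).toAffineEquiv.linear : Space →ₗ[ℝ] Space)
      = -1 := by
  have h1 : ((EuclideanGeometry.reflection P).toAffineEquiv.linear : Space →ₗ[ℝ] Space) =
      P.direction.reflection.toLinearMap := by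
    ext1 v
    have h := (EuclideanGeometry.reflection P).toAffineEquiv.map_vadd (Classical.arbitrary P) v
    simp only [AffineIsometryEquiv.coe_toAffineEquiv] at h
    rw [EuclideanGeometry.reflection_apply, EuclideanGeometry.reflection_apply, vadd_vsub_assoc,
      map_add, vsub_self, map_zero, add_zero, zero_vadd] at h
    exact (vadd_right_cancel _ h).symm
  have h2 := P.direction.finrank_add_finrank_orthogonal
  rw [hP, finrank_euclideanSpace_fin] at h2
  have h3 := P.direction.det_reflection
  rw [show Module.finrank ℝ P.directionᗮ = 1 by omega, pow_one] at h3
  rw [h1, ← h3]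

theorem Interlacing.IsUniform.mirror {n : ℕ} {A : Interlacing n} {ε : SignType}
    (h : A.IsUniform ε) (P : AffineSubspace ℝ Space) [Nonempty P]
    (hP : Module.finrank ℝ P.direction = 2) : (A.mirror P).IsUniform (-ε) := by
  intro l hl m hm k hk hlm hlk hmk
  obtain ⟨l, hl', rfl⟩ := Finset.mem_map.1 hl
  obtain ⟨m, hm', rfl⟩ := Finset.mem_map.1 hm
  obtain ⟨k, hk', rfl⟩ := Finset.mem_map.1 hk
  exact (h l hl' m hm' k hk' (fun e => hlm (by rw [e])) (fun e => hlk (by rw [e]))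
    (fun e => hmk (by rw [e]))).map_neg _ (det_linear_reflection P hP)

theorem map_reflection_map_reflection (P : AffineSubspace ℝ Space) [Nonempty P]
    (l : AffineSubspace ℝ Space) :
    (l.map (EuclideanGeometry.reflection P).toAffineEquiv.toAffineMap).map
      (EuclideanGeometry.reflection P).toAffineEquiv.toAffineMap = l := by
  apply SetLike.coe_injective
  rw [AffineSubspace.coe_map, AffineSubspace.coe_map, Set.image_image]
  simp

theorem Interlacing.isUniform_mirror_iff {n : ℕ} {A : Interlacing n} {ε : SignType}
    (P : AffineSubspace ℝ Space) [Nonempty P] (hP : Module.finrank ℝ P.direction = 2) :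
    (A.mirror P).IsUniform ε ↔ A.IsUniform (-ε) := by
  refine ⟨fun h l hl m hm k hk hlm hlk hmk => ?_, fun h => by simpa using h.mirror P hP⟩
  have mem : ∀ l ∈ A.lines, l.map (EuclideanGeometry.reflection P).toAffineEquiv.toAffineMap ∈
      (A.mirror P).lines := fun l hl => Finset.mem_map.2 ⟨l, hl, rfl⟩
  have inj : ∀ {l m : AffineSubspace ℝ Space}, l ≠ m →
      l.map (EuclideanGeometry.reflection P).toAffineEquiv.toAffineMap ≠
        m.map (EuclideanGeometry.reflection P).toAffineEquiv.toAffineMap := fun hne e => hne <| by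
    simpa only [map_reflection_map_reflection] using congrArg
      (AffineSubspace.map (EuclideanGeometry.reflection P).toAffineEquiv.toAffineMap) e
  have := (h _ (mem l hl) _ (mem m hm) _ (mem k hk) (inj hlm) (inj hlk) (inj hmk)).map_neg _
    (det_linear_reflection P hP)
  rwa [map_reflection_map_reflection, map_reflection_map_reflection,
    map_reflection_map_reflection] at this

open Matrix

/-! ### Lines in homogeneous coordinates -/

/-- Indices of the homogeneous coordinates of space. The last one, `Sum.inr 1`, vanishes on the
plane at infinity; the division into two pairs is used for writing matrices in blocks. -/
abbrev HIndex : Type := Fin 2 ⊕ Fin 2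

/-- The homogeneous coordinates that correspond to the affine coordinates. -/
def affineIndex : Fin 3 → HIndex := ![Sum.inl 0, Sum.inl 1, Sum.inr 0]

/-- The vector with affine part `x` and last coordinate `s`: a point for `s = 1`, a direction
for `s = 0`. -/
def homog (x : Space) (s : ℝ) : HIndex → ℝ := Sum.elim ![x 0, x 1] ![x 2, s]

/-- The matrix whose columns are the homogeneous coordinates of a point and of a direction. -/
def homogLine (p v : Space) : Matrix HIndex (Fin 2) ℝ := of fun i => ![homog p 1 i, homog v 0 i]

/-- A direction vector of the line spanned by the columns of `F`. -/
noncomputable def affineDir (F : Matrix HIndex (Fin 2) ℝ) : Space :=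
  WithLp.toLp 2 fun k => F (Sum.inr 1) 0 * F (affineIndex k) 1 -
    F (Sum.inr 1) 1 * F (affineIndex k) 0

/-- A point of the line spanned by the columns of `F`; a formula that is continuous as long as the
line is not at infinity. -/
noncomputable def affinePoint (F : Matrix HIndex (Fin 2) ℝ) : Space :=
  WithLp.toLp 2 fun k => (F (Sum.inr 1) 0 * F (affineIndex k) 0 +
    F (Sum.inr 1) 1 * F (affineIndex k) 1) / (F (Sum.inr 1) 0 ^ 2 + F (Sum.inr 1) 1 ^ 2)

/-- The affine line spanned by the columns of `F`. -/
noncomputable def lineOf (F : Matrix HIndex (Fin 2) ℝ) : AffineSubspace ℝ Space :=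
  lineThrough (affinePoint F) (affineDir F)

theorem sq_add_sq_ne_zero_of_ne_zero {u : Fin 2 → ℝ} (hu : u ≠ 0) : u 0 ^ 2 + u 1 ^ 2 ≠ 0 := by
  intro h
  refine hu (funext fun k => ?_)
  fin_cases k <;> simp <;> nlinarith [sq_nonneg (u 0), sq_nonneg (u 1)]

theorem linkDet_eq_neg_det (p v q w : Space) :
    linkDet p v q w = -(fromCols (homogLine p v) (homogLine q w)).det := by
  rw [linkDet_eq, ← det_submatrix_equiv_self finSumFinEquiv.symm]
  simp [det_succ_row_zero, Fin.sum_univ_succ, homogLine, homog, Fin.succAbove, finSumFinEquiv,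
    Fin.addCases]
  ring

theorem homogLine_affine {F : Matrix HIndex (Fin 2) ℝ} (hF : F (Sum.inr 1) ≠ 0) :
    ∃ k : Matrix (Fin 2) (Fin 2) ℝ, k.det = 1 ∧
      homogLine (affinePoint F) (affineDir F) = F * k := by
  have hN := sq_add_sq_ne_zero_of_ne_zero hF
  set N := F (Sum.inr 1) 0 ^ 2 + F (Sum.inr 1) 1 ^ 2 with hNdef
  refine ⟨!![F (Sum.inr 1) 0 / N, -F (Sum.inr 1) 1; F (Sum.inr 1) 1 / N, F (Sum.inr 1) 0], ?_, ?_⟩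
  · rw [det_fin_two_of]; field_simp; rw [hNdef]; ring
  · ext i j
    rcases i with i | i <;> fin_cases i <;> fin_cases j <;>
      simp [homogLine, homog, affinePoint, affineDir, affineIndex, mul_apply, ← hNdef] <;>
      field_simp <;> (try rw [hNdef]) <;> ring

theorem det_fromCols_mul (F G : Matrix HIndex (Fin 2) ℝ) (k l : Matrix (Fin 2) (Fin 2) ℝ) :
    (fromCols (F * k) (G * l)).det = (fromCols F G).det * (k.det * l.det) := by
  rw [show fromCols (F * k) (G * l) = fromCols F G * fromBlocks k 0 0 l by
    rw [fromCols_mul_fromBlocks]; simp, det_mul, det_fromBlocks_zero₂₁]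

theorem linkDet_affine {F G : Matrix HIndex (Fin 2) ℝ} (hF : F (Sum.inr 1) ≠ 0)
    (hG : G (Sum.inr 1) ≠ 0) :
    linkDet (affinePoint F) (affineDir F) (affinePoint G) (affineDir G) =
      -(fromCols F G).det := by
  obtain ⟨k, hk, hk'⟩ := homogLine_affine hF
  obtain ⟨l, hl, hl'⟩ := homogLine_affine hG
  rw [linkDet_eq_neg_det, hk', hl', det_fromCols_mul, hk, hl, mul_one, mul_one]

theorem mem_lineThrough_iff_homog {p v x : Space} :
    x ∈ lineThrough p v ↔ ∃ c, homogLine p v *ᵥ c = homog x 1 := by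
  rw [mem_lineThrough]
  constructor
  · rintro ⟨s, rfl⟩
    refine ⟨![1, s], funext fun i => ?_⟩
    rcases i with i | i <;> fin_cases i <;> simp [homogLine, homog, mulVec, dotProduct, mul_comm]
  · rintro ⟨c, hc⟩
    have h : ∀ i, homogLine p v i 0 * c 0 + homogLine p v i 1 * c 1 = homog x 1 i := fun i => by
      rw [← hc]; simp [mulVec, dotProduct]
    have h1 := h (Sum.inr 1)
    simp [homogLine, homog] at h1
    refine ⟨c 1, ?_⟩
    ext k
    fin_cases k
    · have := h (Sum.inl 0)
      simp [homogLine, homog, h1] at this ⊢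
      linarith
    · have := h (Sum.inl 1)
      simp [homogLine, homog, h1] at this ⊢
      linarith
    · have := h (Sum.inr 0)
      simp [homogLine, homog, h1] at this ⊢
      linarith

theorem mulVec_mul_right_iff {F : Matrix HIndex (Fin 2) ℝ} {k : Matrix (Fin 2) (Fin 2) ℝ}
    (hk : k.det ≠ 0) (y : HIndex → ℝ) : (∃ c, (F * k) *ᵥ c = y) ↔ ∃ c, F *ᵥ c = y := by
  constructor
  · rintro ⟨c, rfl⟩
    exact ⟨k *ᵥ c, by rw [mulVec_mulVec]⟩
  · rintro ⟨c, rfl⟩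
    exact ⟨k⁻¹ *ᵥ c, by rw [mulVec_mulVec, Matrix.mul_assoc, mul_nonsing_inv _ hk.isUnit,
      Matrix.mul_one]⟩

theorem mem_lineOf {F : Matrix HIndex (Fin 2) ℝ} (hF : F (Sum.inr 1) ≠ 0) {x : Space} :
    x ∈ lineOf F ↔ ∃ c, F *ᵥ c = homog x 1 := by
  obtain ⟨k, hk, hk'⟩ := homogLine_affine hF
  rw [lineOf, mem_lineThrough_iff_homog, hk', mulVec_mul_right_iff (by rw [hk]; exact one_ne_zero)]

theorem mul_apply_ne_zero {F : Matrix HIndex (Fin 2) ℝ} {k : Matrix (Fin 2) (Fin 2) ℝ}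
    (hk : k.det ≠ 0) {i : HIndex} (hF : F i ≠ 0) : (F * k) i ≠ 0 := by
  intro h
  rw [mul_apply_eq_vecMul] at h
  exact hF (Matrix.eq_zero_of_vecMul_eq_zero hk h)

/-- A line does not depend on the choice of a basis of the plane of its homogeneous coordinates. -/
theorem lineOf_mul {F : Matrix HIndex (Fin 2) ℝ} {k : Matrix (Fin 2) (Fin 2) ℝ}
    (hF : F (Sum.inr 1) ≠ 0) (hk : k.det ≠ 0) : lineOf (F * k) = lineOf F := by
  ext x
  rw [mem_lineOf (mul_apply_ne_zero hk hF), mem_lineOf hF, mulVec_mul_right_iff hk]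

theorem homogLine_inr_one_ne_zero (p v : Space) : homogLine p v (Sum.inr 1) ≠ 0 := fun h => by
  simpa [homogLine, homog] using congrFun h 0

theorem lineOf_homogLine (p v : Space) : lineOf (homogLine p v) = lineThrough p v := by
  ext x
  rw [mem_lineOf (homogLine_inr_one_ne_zero p v), mem_lineThrough_iff_homog]

theorem continuousOn_affinePoint :
    ContinuousOn affinePoint {F | F (Sum.inr 1) ≠ 0} := by
  refine (PiLp.continuous_toLp 2 _).comp_continuousOn (continuousOn_pi.2 fun k => ?_)
  exact ContinuousOn.div (by fun_prop) (by fun_prop) fun F hF => sq_add_sq_ne_zero_of_ne_zero hF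

theorem continuous_affineDir : Continuous affineDir := by
  unfold affineDir
  fun_prop

/-! ### Normal form of four lines -/

/-- The planes `x = (s, 0)`, `(0, s)`, `(s, s)` and `(s, M s)` in `ℝ² ⊕ ℝ²`, regarded as lines in
projective space: up to projective equivalence, any four pairwise disjoint lines look like this. -/
def normalLine (M : Matrix (Fin 2) (Fin 2) ℝ) : Fin 4 → Matrix HIndex (Fin 2) ℝ :=
  ![fromRows 1 0, fromRows 0 1, fromRows 1 1, fromRows 1 M]

/-- Pairs of a homogeneous coordinate change `g` and a matrix `M` for which the images under `g` of
the four lines in normal form are pairwise skew lines of affine space, none of them at infinity. -/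
def charts : Set (Matrix HIndex HIndex ℝ × Matrix (Fin 2) (Fin 2) ℝ) :=
  {c | c.1.det ≠ 0 ∧ c.2.det ≠ 0 ∧ (c.2 - 1).det ≠ 0 ∧
    ∀ i, (c.1 * normalLine c.2 i) (Sum.inr 1) ≠ 0}

/-- The frame of the lines described by a pair in `charts`. -/
noncomputable def chartFrame (c : Matrix HIndex HIndex ℝ × Matrix (Fin 2) (Fin 2) ℝ) :
    (Fin 4 → Space) × (Fin 4 → Space) :=
  (fun i => affinePoint (c.1 * normalLine c.2 i), fun i => affineDir (c.1 * normalLine c.2 i))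

theorem det_fromBlocks_zero_one (A B : Matrix (Fin 2) (Fin 2) ℝ) :
    (fromBlocks 0 A 1 B).det = A.det := by
  have h : (fromBlocks 0 A 1 B : Matrix HIndex HIndex ℝ) *
      (fromBlocks 1 (1 - B) 0 1 : Matrix HIndex HIndex ℝ) = fromBlocks 0 A 1 1 := by
    rw [fromBlocks_multiply]; simp
  have h' := congrArg det h
  rw [det_mul, det_fromBlocks_zero₂₁, det_one, mul_one, mul_one, det_fromBlocks_one₂₂,
    Matrix.mul_one, zero_sub, det_neg] at h'
  simpa using h'

/-- The determinants of the pairs of lines in normal form. -/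
theorem det_normalLine (M : Matrix (Fin 2) (Fin 2) ℝ) :
    (fromCols (normalLine M 0) (normalLine M 1)).det = 1 ∧
    (fromCols (normalLine M 0) (normalLine M 2)).det = 1 ∧
    (fromCols (normalLine M 0) (normalLine M 3)).det = M.det ∧
    (fromCols (normalLine M 1) (normalLine M 2)).det = 1 ∧
    (fromCols (normalLine M 1) (normalLine M 3)).det = 1 ∧
    (fromCols (normalLine M 2) (normalLine M 3)).det = (M - 1).det := by
  have h := @fromCols_fromRows_eq_fromBlocks ℝ (Fin 2) (Fin 2) (Fin 2) (Fin 2)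
  simp only [normalLine, cons_val]
  refine ⟨?_, ?_, ?_, ?_, ?_, ?_⟩
  · rw [h, fromBlocks_one, det_one]
  · rw [h, det_fromBlocks_zero₂₁, det_one, mul_one]
  · rw [h, det_fromBlocks_zero₂₁, det_one, one_mul]
  · rw [h, det_fromBlocks_zero_one, det_one]
  · rw [h, det_fromBlocks_zero_one, det_one]
  · rw [h, det_fromBlocks_one₁₁, Matrix.one_mul]

theorem linkDet_chartFrame {c : Matrix HIndex HIndex ℝ × Matrix (Fin 2) (Fin 2) ℝ}
    (hc : c ∈ charts) (i j : Fin 4) :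
    linkDet ((chartFrame c).1 i) ((chartFrame c).2 i) ((chartFrame c).1 j) ((chartFrame c).2 j) =
      -(c.1.det * (fromCols (normalLine c.2 i) (normalLine c.2 j)).det) := by
  rw [chartFrame, linkDet_affine (hc.2.2.2 i) (hc.2.2.2 j), ← mul_fromCols, det_mul]

theorem chartFrame_mem_frames {c : Matrix HIndex HIndex ℝ × Matrix (Fin 2) (Fin 2) ℝ}
    (hc : c ∈ charts) : chartFrame c ∈ frames 4 := by
  rw [mem_frames_iff]
  have key : ∀ i j : Fin 4, i < j → linkDet ((chartFrame c).1 i) ((chartFrame c).2 i)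
      ((chartFrame c).1 j) ((chartFrame c).2 j) ≠ 0 := by
    intro i j hij
    rw [linkDet_chartFrame hc]
    refine neg_ne_zero.2 (mul_ne_zero hc.1 ?_)
    obtain ⟨h01, h02, h03, h12, h13, h23⟩ := det_normalLine c.2
    fin_cases i <;> fin_cases j <;> simp at hij <;>
      simp [h01, h02, h03, h12, h13, h23, hc.2.1, hc.2.2.1]
  intro i j hij
  rcases lt_or_gt_of_ne hij with h | h
  · exact key i j h
  · rw [← linkDet_comm]
    exact key j i h

theorem continuous_normalLine (i : Fin 4) : Continuous fun M => normalLine M i := by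
  fin_cases i
  · exact continuous_const
  · exact continuous_const
  · exact continuous_const
  · refine continuous_matrix fun a b => ?_
    rcases a with a | a
    · exact continuous_const
    · exact continuous_id.matrix_elem a b

theorem joinedIn_chartFrame {c d : Matrix HIndex HIndex ℝ × Matrix (Fin 2) (Fin 2) ℝ}
    (h : JoinedIn charts c d) : JoinedIn (frames 4) (chartFrame c) (chartFrame d) := by
  have hF : ∀ i, Continuous fun c : Matrix HIndex HIndex ℝ × Matrix (Fin 2) (Fin 2) ℝ =>
      c.1 * normalLine c.2 i := fun i =>
    continuous_fst.matrix_mul ((continuous_normalLine i).comp continuous_snd)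
  refine (h.map_continuousOn (f := chartFrame) ?_).mono ?_
  · refine ContinuousOn.prodMk (continuousOn_pi.2 fun i => ?_) (continuousOn_pi.2 fun i => ?_)
    · exact continuousOn_affinePoint.comp (hF i).continuousOn fun c hc => hc.2.2.2 i
    · exact (continuous_affineDir.comp (hF i)).continuousOn
  · rintro _ ⟨c, hc, rfl⟩
    exact chartFrame_mem_frames hc

/-- The lines of an arbitrary frame are the images of four lines in normal form. -/
theorem exists_chart {x : (Fin 4 → Space) × (Fin 4 → Space)} (hx : x ∈ frames 4) :
    ∃ c ∈ charts, ∀ i, lineThrough ((chartFrame c).1 i) ((chartFrame c).2 i) =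
      lineThrough (x.1 i) (x.2 i) := by
  set F : Fin 4 → Matrix HIndex (Fin 2) ℝ := fun i => homogLine (x.1 i) (x.2 i) with hF
  have hlast : ∀ i, F i (Sum.inr 1) ≠ 0 := fun i => homogLine_inr_one_ne_zero _ _
  have hdet : ∀ {i j}, i ≠ j → (fromCols (F i) (F j)).det ≠ 0 := fun {i j} hij => by
    have := linkDet_ne_zero_of_mem_frames hx hij
    rwa [linkDet_eq_neg_det, neg_ne_zero] at this
  -- The first two lines serve as coordinate planes.
  set g₀ := fromCols (F 0) (F 1) with hg₀
  have hg₀' : g₀.det ≠ 0 := hdet (by decide)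
  have h0 : F 0 = g₀ * (fromRows 1 0 : Matrix HIndex (Fin 2) ℝ) := by
    rw [hg₀, fromCols_mul_fromRows]; simp
  have h1 : F 1 = g₀ * (fromRows 0 1 : Matrix HIndex (Fin 2) ℝ) := by
    rw [hg₀, fromCols_mul_fromRows]; simp
  have hrows : ∀ i, i ≠ 0 → i ≠ 1 → ∃ A B : Matrix (Fin 2) (Fin 2) ℝ, A.det ≠ 0 ∧ B.det ≠ 0 ∧
      F i = g₀ * (fromRows A B : Matrix HIndex (Fin 2) ℝ) := by
    intro i hi0 hi1
    have hi : F i = g₀ * (fromRows (toRows₁ (g₀⁻¹ * F i)) (toRows₂ (g₀⁻¹ * F i)) :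
        Matrix HIndex (Fin 2) ℝ) := by
      rw [fromRows_toRows, ← Matrix.mul_assoc, mul_nonsing_inv _ hg₀'.isUnit, Matrix.one_mul]
    refine ⟨_, _, ?_, ?_, hi⟩
    · have := hdet hi1.symm
      rw [h1, hi, ← mul_fromCols, det_mul, fromCols_fromRows_eq_fromBlocks,
        det_fromBlocks_zero_one] at this
      exact right_ne_zero_of_mul this
    · have := hdet hi0.symm
      rw [h0, hi, ← mul_fromCols, det_mul, fromCols_fromRows_eq_fromBlocks,
        det_fromBlocks_zero₂₁, det_one, one_mul] at this
      exact right_ne_zero_of_mul this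
  obtain ⟨A, B, hA, hB, h2⟩ := hrows 2 (by decide) (by decide)
  obtain ⟨A', B', hA', hB', h3⟩ := hrows 3 (by decide) (by decide)
  -- Rescaling the second plane turns the third line into the diagonal.
  set C := B * A⁻¹ with hC
  have hAi : A⁻¹.det ≠ 0 := by rw [det_nonsing_inv]; simpa using hA
  have hAi' : A'⁻¹.det ≠ 0 := by rw [det_nonsing_inv]; simpa using hA'
  have hCdet : C.det ≠ 0 := by rw [hC, det_mul]; exact mul_ne_zero hB hAi
  set g := g₀ * (fromBlocks 1 0 0 C : Matrix HIndex HIndex ℝ) with hg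
  set M := C⁻¹ * (B' * A'⁻¹) with hM
  have hk : ∀ i, ∃ k : Matrix (Fin 2) (Fin 2) ℝ, k.det ≠ 0 ∧ g * normalLine M i = F i * k := by
    intro i
    fin_cases i
    · refine ⟨1, by simp, ?_⟩
      simp [normalLine, hg, Matrix.mul_assoc, fromBlocks_mul_fromRows, h0]
    · refine ⟨C, hCdet, ?_⟩
      simp [normalLine, hg, Matrix.mul_assoc, fromBlocks_mul_fromRows, h1, fromRows_mul]
    · refine ⟨A⁻¹, hAi, ?_⟩
      simp [normalLine, hg, Matrix.mul_assoc, fromBlocks_mul_fromRows, h2, fromRows_mul, hC,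
        mul_nonsing_inv _ hA.isUnit]
    · refine ⟨A'⁻¹, hAi', ?_⟩
      simp only [normalLine, hg, Matrix.mul_assoc, fromBlocks_mul_fromRows, h3, fromRows_mul, hM,
        mul_nonsing_inv _ hA'.isUnit, Fin.reduceFinMk, cons_val, Matrix.one_mul, Matrix.zero_mul,
        add_zero, zero_add]
      rw [← Matrix.mul_assoc C, mul_nonsing_inv _ hCdet.isUnit, Matrix.one_mul]
  choose k hkdet hk using hk
  have hdet' : ∀ {i j}, i ≠ j → (fromCols (normalLine M i) (normalLine M j)).det ≠ 0 := by
    intro i j hij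
    have := mul_ne_zero (hdet hij) (mul_ne_zero (hkdet i) (hkdet j))
    rw [← det_fromCols_mul, ← hk, ← hk, ← mul_fromCols, det_mul] at this
    exact right_ne_zero_of_mul this
  obtain ⟨-, -, h03, -, -, h23⟩ := det_normalLine M
  refine ⟨(g, M), ⟨?_, h03 ▸ hdet' (by decide), h23 ▸ hdet' (by decide), fun i => ?_⟩, fun i => ?_⟩
  · rw [hg, det_mul, det_fromBlocks_zero₂₁, det_one, one_mul]
    exact mul_ne_zero hg₀' hCdet
  · simp only [hk]
    exact mul_apply_ne_zero (hkdet i) (hlast i)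
  · change lineOf (g * normalLine M i) = _
    rw [hk, lineOf_mul (hlast i) (hkdet i), hF, lineOf_homogLine]

/-! ### Orientation-preserving affine maps form a connected set -/

theorem joinedIn_of_segment {E : Type*} [AddCommGroup E] [Module ℝ E] [TopologicalSpace E]
    [ContinuousAdd E] [ContinuousSMul ℝ E] {S : Set E} {x y : E}
    (h : ∀ θ : ℝ, 0 ≤ θ → θ ≤ 1 → x + θ • (y - x) ∈ S) : JoinedIn S x y := by
  refine JoinedIn.of_segment_subset ?_
  rw [segment_eq_image']
  rintro _ ⟨θ, hθ, rfl⟩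
  exact h θ hθ.1 hθ.2

/-- The half turns about the three coordinate axes are connected to the identity. -/
theorem joinedIn_half_turn {a b c : ℝ} (ha : a = 1 ∨ a = -1) (hb : b = 1 ∨ b = -1)
    (hc : c = 1 ∨ c = -1) (habc : a * b * c = 1) :
    JoinedIn {B : Matrix (Fin 3) (Fin 3) ℝ | B.det ≠ 0} (diagonal ![a, b, c]) 1 := by
  have hpos : ∀ θ : ℝ, (1 - θ) ^ 2 + θ ^ 2 ≠ 0 := fun θ => by nlinarith [sq_nonneg (2 * θ - 1)]
  have one : (1 : Matrix (Fin 3) (Fin 3) ℝ) = diagonal ![1, 1, 1] := by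
    ext i j; fin_cases i <;> fin_cases j <;> simp
  -- A half turn is reached in two straight steps through a quarter turn.
  have key : ∀ Q D : Matrix (Fin 3) (Fin 3) ℝ,
      (∀ θ : ℝ, (D + θ • (Q - D)).det = (1 - θ) ^ 2 + θ ^ 2) →
      (∀ θ : ℝ, (Q + θ • (1 - Q)).det = (1 - θ) ^ 2 + θ ^ 2) →
      JoinedIn {B : Matrix (Fin 3) (Fin 3) ℝ | B.det ≠ 0} D 1 := fun Q D h1 h2 =>
    (joinedIn_of_segment fun θ _ _ => by rw [Set.mem_ofPred_eq, h1]; exact hpos θ).trans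
      (joinedIn_of_segment fun θ _ _ => by rw [Set.mem_ofPred_eq, h2]; exact hpos θ)
  rcases ha with rfl | rfl <;> rcases hb with rfl | rfl <;> rcases hc with rfl | rfl <;>
    norm_num at habc
  · rw [one]
    refine JoinedIn.refl ?_
    rw [← one]; simp
  · refine key !![1, 0, 0; 0, 0, -1; 0, 1, 0] _ (fun θ => ?_) (fun θ => ?_) <;>
      simp [det_fin_three] <;> ring
  · refine key !![0, 0, -1; 0, 1, 0; 1, 0, 0] _ (fun θ => ?_) (fun θ => ?_) <;>
      simp [det_fin_three] <;> ring
  · refine key !![0, -1, 0; 1, 0, 0; 0, 0, 1] _ (fun θ => ?_) (fun θ => ?_) <;>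
      simp [det_fin_three] <;> ring

theorem joinedIn_neg {A B : Matrix (Fin 3) (Fin 3) ℝ}
    (h : JoinedIn {B : Matrix (Fin 3) (Fin 3) ℝ | B.det ≠ 0} A B) :
    JoinedIn {B : Matrix (Fin 3) (Fin 3) ℝ | B.det ≠ 0} (-A) (-B) := by
  refine (h.map (f := fun X => -X) continuous_neg).mono ?_
  rintro _ ⟨X, hX, rfl⟩
  simpa [det_neg] using hX

/-- The group of invertible real `3 × 3` matrices has at most two components. -/
theorem joinedIn_one_or_neg_one {B : Matrix (Fin 3) (Fin 3) ℝ} (hB : B.det ≠ 0) :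
    JoinedIn {B : Matrix (Fin 3) (Fin 3) ℝ | B.det ≠ 0} B 1 ∨
      JoinedIn {B : Matrix (Fin 3) (Fin 3) ℝ | B.det ≠ 0} B (-1) := by
  refine diagonal_transvection_induction_of_det_ne_zero
    (fun B => JoinedIn {B : Matrix (Fin 3) (Fin 3) ℝ | B.det ≠ 0} B 1 ∨
      JoinedIn {B : Matrix (Fin 3) (Fin 3) ℝ | B.det ≠ 0} B (-1)) B hB ?_ ?_ ?_
  · intro D hD
    have hD' : ∀ i, D i ≠ 0 := by
      rw [det_diagonal, Finset.prod_ne_zero_iff] at hD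
      exact fun i => hD i (Finset.mem_univ i)
    have hsign : ∀ i, ∃ s : ℝ, (s = 1 ∨ s = -1) ∧ 0 < D i * s := fun i => by
      rcases lt_or_gt_of_ne (hD' i) with h | h
      · exact ⟨-1, Or.inr rfl, by linarith⟩
      · exact ⟨1, Or.inl rfl, by linarith⟩
    choose s hs hDs using hsign
    have h1 : JoinedIn {B : Matrix (Fin 3) (Fin 3) ℝ | B.det ≠ 0} (diagonal D) (diagonal s) := by
      refine joinedIn_of_segment fun θ h0 h1 => ?_
      rw [show diagonal D + θ • (diagonal s - diagonal D) = diagonal (D + θ • (s - D)) by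
        ext i j; by_cases h : i = j <;> simp [diagonal, h], Set.mem_ofPred_eq, det_diagonal]
      refine Finset.prod_ne_zero_iff.2 fun i _ h => ?_
      have hss : s i * s i = 1 := by rcases hs i with h | h <;> rw [h] <;> norm_num
      have h3 : (1 - θ) * (D i * s i) + θ = 0 := by
        simp only [Pi.add_apply, Pi.smul_apply, Pi.sub_apply, smul_eq_mul] at h
        linear_combination s i * h - θ * hss
      rcases h0.eq_or_lt with h4 | h4
      · rw [← h4] at h3; linarith [hDs i]
      · linarith [mul_nonneg (sub_nonneg.2 h1) (hDs i).le]
    have hs' : s = ![s 0, s 1, s 2] := by ext i; fin_cases i <;> rfl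
    have hprod : s 0 * s 1 * s 2 = 1 ∨ -s 0 * -s 1 * -s 2 = 1 := by
      rcases hs 0 with h | h <;> rcases hs 1 with h' | h' <;> rcases hs 2 with h'' | h'' <;>
        rw [h, h', h''] <;> norm_num
    have hneg : ∀ i, -s i = 1 ∨ -s i = -1 := fun i => by
      rcases hs i with h | h <;> rw [h] <;> norm_num
    rcases hprod with h | h
    · exact Or.inl (h1.trans (hs' ▸ joinedIn_half_turn (hs 0) (hs 1) (hs 2) h))
    · refine Or.inr (h1.trans ?_)
      have h2 := joinedIn_neg (joinedIn_half_turn (hneg 0) (hneg 1) (hneg 2) h)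
      rwa [show -diagonal ![-s 0, -s 1, -s 2] = diagonal s by
        ext i j; fin_cases i <;> fin_cases j <;> simp] at h2
  · intro t
    refine Or.inl (joinedIn_of_segment fun θ _ _ => ?_)
    rw [Set.mem_ofPred_eq, show t.toMatrix + θ • (1 - t.toMatrix) =
      transvection t.i t.j ((1 - θ) * t.c) by
        rw [TransvectionStruct.toMatrix, transvection, transvection, sub_add_cancel_left,
          ← smul_eq_mul, ← smul_single]
        module, det_transvection_of_ne _ _ t.hij]
    exact one_ne_zero
  · intro A B hA hB ihA ihB
    have mul : ∀ {a b : Matrix (Fin 3) (Fin 3) ℝ},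
        JoinedIn {B : Matrix (Fin 3) (Fin 3) ℝ | B.det ≠ 0} A a →
        JoinedIn {B : Matrix (Fin 3) (Fin 3) ℝ | B.det ≠ 0} B b →
        JoinedIn {B : Matrix (Fin 3) (Fin 3) ℝ | B.det ≠ 0} (A * B) (a * b) := by
      intro a b ha hb
      refine (ha.mul hb).mono ?_
      rintro _ ⟨X, hX, Y, hY, rfl⟩
      rw [Set.mem_ofPred_eq, det_mul]
      exact mul_ne_zero hX hY
    rcases ihA with h | h <;> rcases ihB with h' | h'
    · exact Or.inl (by simpa using mul h h')
    · exact Or.inr (by simpa using mul h h')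
    · exact Or.inr (by simpa using mul h h')
    · exact Or.inl (by simpa using mul h h')

/-- Separation of the last homogeneous coordinate from the other three. -/
def affineSplit : HIndex ≃ Fin 3 ⊕ Fin 1 :=
  (finSumFinEquiv (m := 2) (n := 2)).trans (finSumFinEquiv (m := 3) (n := 1)).symm

/-- Orientation-preserving affine maps, written as matrices in homogeneous coordinates, are
connected to the identity. -/
theorem joinedIn_affine {α : Matrix HIndex HIndex ℝ} (hα : 0 < α.det)
    (hlast : α (Sum.inr 1) = Pi.single (Sum.inr 1) 1) :
    JoinedIn {β : Matrix HIndex HIndex ℝ | β.det ≠ 0 ∧ β (Sum.inr 1) = Pi.single (Sum.inr 1) 1}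
      α 1 := by
  set T := {β : Matrix HIndex HIndex ℝ | β.det ≠ 0 ∧ β (Sum.inr 1) = Pi.single (Sum.inr 1) 1}
  let f : Matrix (Fin 3) (Fin 3) ℝ → Matrix (Fin 3) (Fin 1) ℝ → Matrix HIndex HIndex ℝ :=
    fun B t => (fromBlocks B t 0 1).submatrix affineSplit affineSplit
  have he : affineSplit (Sum.inr 1) = Sum.inr 0 := by decide
  have hdet : ∀ B t, (f B t).det = B.det := fun B t => by
    rw [det_submatrix_equiv_self, det_fromBlocks_zero₂₁, det_one, mul_one]
  have hf1 : f 1 0 = 1 := by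
    simp only [f, fromBlocks_one, submatrix_one_equiv]
  have hrow : ∀ B t, f B t (Sum.inr 1) = Pi.single (Sum.inr 1) 1 := fun B t => by
    have : ∀ j, (fromBlocks B t 0 1 : Matrix (Fin 3 ⊕ Fin 1) (Fin 3 ⊕ Fin 1) ℝ) (Sum.inr 0)
        (affineSplit j) = (1 : Matrix (Fin 3 ⊕ Fin 1) (Fin 3 ⊕ Fin 1) ℝ) (Sum.inr 0)
        (affineSplit j) := fun j => by
      rcases affineSplit j with k | k <;> simp [one_apply]
    ext j
    simp only [f, submatrix_apply, he, this]
    rw [← he, one_apply, Pi.single_apply]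
    simp [eq_comm]
  have hmem : ∀ B t, B.det ≠ 0 → f B t ∈ T := fun B t hB => ⟨by rwa [hdet], hrow B t⟩
  obtain ⟨B, t, rfl⟩ : ∃ B t, f B t = α := by
    set α' := α.submatrix affineSplit.symm affineSplit.symm with hα'
    refine ⟨α'.toBlocks₁₁, α'.toBlocks₁₂, ?_⟩
    have h21 : α'.toBlocks₂₁ = 0 := by
      ext i j
      have hi : i = 0 := Subsingleton.elim _ _
      rw [hi, hα']
      simp only [toBlocks₂₁, of_apply, submatrix_apply, ← he, Equiv.symm_apply_apply, hlast]
      rw [Pi.single_apply, if_neg]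
      · rfl
      · rw [Equiv.symm_apply_eq, he]; simp
    have h22 : α'.toBlocks₂₂ = 1 := by
      ext i j
      have hi : i = 0 := Subsingleton.elim _ _
      have hj : j = 0 := Subsingleton.elim _ _
      rw [hi, hj, hα']
      simp [toBlocks₂₂, ← he, hlast]
    simp only [f]
    rw [← h21, ← h22, fromBlocks_toBlocks, hα']
    simp
  rw [hdet] at hα
  have hfc : ∀ t, Continuous fun B => f B t := fun t =>
    (Continuous.matrix_fromBlocks continuous_id continuous_const continuous_const
      continuous_const).matrix_submatrix _ _
  rcases joinedIn_one_or_neg_one hα.ne' with h | h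
  · have h1 : JoinedIn T (f B t) (f 1 t) := by
      refine (h.map (hfc t)).mono ?_
      rintro _ ⟨X, hX, rfl⟩
      exact hmem X t hX
    refine h1.trans (hf1 ▸ joinedIn_of_segment fun θ _ _ => ?_)
    rw [show f 1 t + θ • (f 1 0 - f 1 t) = f 1 ((1 - θ) • t) by
      ext i j
      simp only [f, Matrix.add_apply, Matrix.smul_apply, Matrix.sub_apply, submatrix_apply,
        smul_eq_mul]
      rcases affineSplit i with k | k <;> rcases affineSplit j with l | l <;> simp
      ring]
    exact hmem _ _ (by simp)
  · obtain ⟨γ, hγ⟩ := h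
    have := sign_eq_of_continuous (f := fun s => (γ s).det) γ.continuous.matrix_det hγ 0 1
    rw [γ.source, γ.target, sign_pos hα, det_neg, det_one, mul_one,
      sign_neg (by norm_num)] at this
    exact absurd this (by decide)

/-! ### Moving the plane at infinity -/

theorem normalLine_mulVec_ne_zero (M : Matrix (Fin 2) (Fin 2) ℝ) (i : Fin 4) {u : Fin 2 → ℝ}
    (hu : u ≠ 0) : normalLine M i *ᵥ u ≠ 0 := by
  intro h
  fin_cases i <;> simp [normalLine, fromRows_mulVec] at h
  all_goals first
    | exact hu (funext fun k => by simpa using congrFun h (Sum.inl k))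
    | exact hu (funext fun k => by simpa using congrFun h (Sum.inr k))

theorem exists_dotProduct_ne_zero {ι κ : Type*} [Finite ι] [Fintype κ]
    (v : ι → κ → ℝ) (hv : ∀ i, v i ≠ 0) : ∃ m : κ → ℝ, ∀ i, m ⬝ᵥ v i ≠ 0 := by
  classical
  obtain ⟨f, hf⟩ := Module.exists_dual_forall_apply_ne_zero (K := ℝ) v hv
  refine ⟨fun j => f (Pi.single j 1), fun i => ?_⟩
  have := hf i
  rw [LinearMap.pi_apply_eq_sum_univ f] at this
  convert! this using 1
  refine Finset.sum_congr rfl fun j _ => ?_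
  rw [smul_eq_mul, mul_comm]
  congr 1
  exact congrArg f (funext fun k => by simp [Pi.single_apply, eq_comm])

/-- Homogeneous coordinates, in the normal form, of the point at infinity of the `i`-th line. A
plane that does not pass through this point spans with the plane at infinity a pencil in which no
plane contains the line. -/
def infinitePoint (c : Matrix HIndex HIndex ℝ × Matrix (Fin 2) (Fin 2) ℝ) (i : Fin 4) :
    HIndex → ℝ :=
  normalLine c.2 i *ᵥ
    ![(c.1 * normalLine c.2 i) (Sum.inr 1) 1, -(c.1 * normalLine c.2 i) (Sum.inr 1) 0]

theorem infinitePoint_ne_zero {c : Matrix HIndex HIndex ℝ × Matrix (Fin 2) (Fin 2) ℝ}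
    (hc : c ∈ charts) (i : Fin 4) : infinitePoint c i ≠ 0 := by
  refine normalLine_mulVec_ne_zero _ _ fun h => hc.2.2.2 i (funext fun k => ?_)
  have h0 := congrFun h 0
  have h1 := congrFun h 1
  simp only [cons_val_zero, cons_val_one, Pi.zero_apply, neg_eq_zero] at h0 h1
  fin_cases k
  · exact h1
  · exact h0

/-- The plane at infinity of a chart can be moved to any plane in general position. -/
theorem joinedIn_change_infinity {g : Matrix HIndex HIndex ℝ} {M : Matrix (Fin 2) (Fin 2) ℝ}
    (hc : (g, M) ∈ charts) {m : HIndex → ℝ} (hm : ∀ i, m ⬝ᵥ infinitePoint (g, M) i ≠ 0) :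
    ∃ g', g' (Sum.inr 1) = m ∧ g'.det = g.det ∧ JoinedIn charts (g, M) (g', M) := by
  set h := g (Sum.inr 1) with hh
  have hrow : ∀ i, (g * normalLine M i) (Sum.inr 1) = h ᵥ* normalLine M i := fun i =>
    mul_apply_eq_vecMul _ _ _
  have hh0 : h ≠ 0 := fun h0 => hc.2.2.2 0 (by rw [hrow, h0, zero_vecMul])
  have hhh : h ⬝ᵥ h ≠ 0 := fun h0 => hh0 (dotProduct_self_eq_zero.1 h0)
  have horth : ∀ i, h ⬝ᵥ infinitePoint (g, M) i = 0 := fun i => by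
    rw [infinitePoint, dotProduct_mulVec, hrow]
    simp [dotProduct, Fin.sum_univ_two]
    ring
  -- The vector `w` takes the value `1` on both planes, so that the determinant stays constant.
  obtain ⟨w, hhw, hmw⟩ : ∃ w, h ⬝ᵥ w = 1 ∧ m ⬝ᵥ w = 1 := by
    refine ⟨(h ⬝ᵥ h)⁻¹ • h +
      ((1 - (h ⬝ᵥ h)⁻¹ * (m ⬝ᵥ h)) / (m ⬝ᵥ infinitePoint (g, M) 0)) •
        infinitePoint (g, M) 0, ?_, ?_⟩
    · rw [dotProduct_add, dotProduct_smul, dotProduct_smul, horth]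
      simp [hhh]
    · rw [dotProduct_add, dotProduct_smul, dotProduct_smul]
      simp [hm 0]
  have hdet : ∀ θ : ℝ, (g + θ • vecMulVec (g *ᵥ w) (m - h)).det = g.det := fun θ => by
    have : g + θ • vecMulVec (g *ᵥ w) (m - h) = g * (1 + vecMulVec w (θ • (m - h))) := by
      rw [Matrix.mul_add, Matrix.mul_one, mul_vecMulVec, vecMulVec_smul]
    rw [this, det_mul, vecMulVec_eq (Fin 1), det_one_add_replicateCol_mul_replicateRow,
      smul_dotProduct, sub_dotProduct, hhw, hmw, sub_self, smul_zero, add_zero, mul_one]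
  have hlast : ∀ θ : ℝ, (g + θ • vecMulVec (g *ᵥ w) (m - h)) (Sum.inr 1) = h + θ • (m - h) := by
    intro θ
    have : (g *ᵥ w) (Sum.inr 1) = 1 := hhw
    ext j
    simp [vecMulVec_apply, this, hh]
  refine ⟨g + (1 : ℝ) • vecMulVec (g *ᵥ w) (m - h), ?_, hdet 1, joinedIn_of_segment ?_⟩
  · rw [hlast]; simp
  · intro θ _ _
    have hseg : (g, M) + θ • ((g + (1 : ℝ) • vecMulVec (g *ᵥ w) (m - h), M) - (g, M)) =
        (g + θ • vecMulVec (g *ᵥ w) (m - h), M) := by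
      ext <;> simp
    rw [hseg]
    refine ⟨by rw [hdet]; exact hc.1, hc.2.1, hc.2.2.1, fun i hi => ?_⟩
    dsimp only at hi
    rw [mul_apply_eq_vecMul, hlast] at hi
    have h1 : (h + θ • (m - h)) ⬝ᵥ infinitePoint (g, M) i = 0 := by
      rw [infinitePoint, dotProduct_mulVec, hi, zero_dotProduct]
    rw [add_dotProduct, smul_dotProduct, sub_dotProduct, horth, sub_zero, zero_add, smul_eq_mul,
      mul_eq_zero, or_iff_left (hm i)] at h1
    rw [h1, zero_smul, add_zero] at hi
    exact hc.2.2.2 i (by rw [hrow]; exact hi)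

/-- Charts with the same plane at infinity and the same orientation differ by an affine motion. -/
theorem joinedIn_of_same_infinity {g g' : Matrix HIndex HIndex ℝ} {M : Matrix (Fin 2) (Fin 2) ℝ}
    (hc : (g, M) ∈ charts) (hrow : g' (Sum.inr 1) = g (Sum.inr 1)) (hdet : 0 < g.det * g'.det) :
    JoinedIn charts (g, M) (g', M) := by
  have hg : g.det ≠ 0 := hc.1
  have hα : g' * g⁻¹ * g = g' := by
    rw [Matrix.mul_assoc, nonsing_inv_mul _ hg.isUnit, Matrix.mul_one]
  have h := joinedIn_affine (α := g' * g⁻¹) ?_ ?_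
  · have hcont : Continuous fun β : Matrix HIndex HIndex ℝ => (β * g, M) := by fun_prop
    have h' := h.symm.map hcont
    rw [hα, Matrix.one_mul] at h'
    refine h'.mono ?_
    rintro _ ⟨β, ⟨hβ, hβ'⟩, rfl⟩
    have hlast : (β * g) (Sum.inr 1) = g (Sum.inr 1) := by
      rw [mul_apply_eq_vecMul, hβ', single_one_vecMul]; rfl
    refine ⟨by rw [det_mul]; exact mul_ne_zero hβ hg, hc.2.1, hc.2.2.1, fun i => ?_⟩
    dsimp only
    rw [mul_apply_eq_vecMul, hlast, ← mul_apply_eq_vecMul]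
    exact hc.2.2.2 i
  · rw [det_mul, det_nonsing_inv, Ring.inverse_eq_inv']
    have : g'.det * g.det⁻¹ = (g.det * g'.det) * (g.det⁻¹) ^ 2 := by field_simp
    rw [this]
    have := inv_ne_zero hg
    positivity
  · rw [mul_apply_eq_vecMul, hrow, ← mul_apply_eq_vecMul, mul_nonsing_inv _ hg.isUnit]
    ext j
    simp [one_apply, Pi.single_apply, eq_comm]

theorem joinedIn_charts_same {g g' : Matrix HIndex HIndex ℝ} {M : Matrix (Fin 2) (Fin 2) ℝ}
    (hc : (g, M) ∈ charts) (hc' : (g', M) ∈ charts) (hdet : 0 < g.det * g'.det) :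
    JoinedIn charts (g, M) (g', M) := by
  obtain ⟨m, hm⟩ := exists_dotProduct_ne_zero
    (fun i : Fin 4 ⊕ Fin 4 => Sum.elim (infinitePoint (g, M)) (infinitePoint (g', M)) i) (by
      rintro (i | i)
      exacts [infinitePoint_ne_zero hc i, infinitePoint_ne_zero hc' i])
  obtain ⟨g₁, h₁, hd₁, hj₁⟩ := joinedIn_change_infinity hc fun i => hm (Sum.inl i)
  obtain ⟨g₂, h₂, hd₂, hj₂⟩ := joinedIn_change_infinity hc' fun i => hm (Sum.inr i)
  exact (hj₁.trans (joinedIn_of_same_infinity hj₁.target_mem (h₂.trans h₁.symm)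
    (by rwa [hd₁, hd₂]))).trans hj₂.symm

/-- A motion of the fourth line in normal form gives a motion of charts: the plane at infinity
can be chosen so close to the second line that it contains none of the lines at any time. -/
theorem joinedIn_charts {g g' : Matrix HIndex HIndex ℝ} {M M' : Matrix (Fin 2) (Fin 2) ℝ}
    (hc : (g, M) ∈ charts) (hc' : (g', M') ∈ charts) (hdet : 0 < g.det * g'.det)
    (hM : JoinedIn {N : Matrix (Fin 2) (Fin 2) ℝ | N.det ≠ 0 ∧ (N - 1).det ≠ 0} M M') :
    JoinedIn charts (g, M) (g', M') := by
  obtain ⟨γ, hγ⟩ := hM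
  have hcont : Continuous fun t => γ t 0 0 := γ.continuous.matrix_elem 0 0
  obtain ⟨R, hR⟩ := (isCompact_range hcont).exists_bound_of_continuousOn
    (f := fun x : ℝ => x) continuousOn_id
  have hR' : ∀ t, |γ t 0 0| ≤ R := fun t => hR _ ⟨t, rfl⟩
  have hR0 : 0 ≤ R := (abs_nonneg _).trans (hR' 0)
  obtain ⟨k, hk⟩ : ∃ k : Matrix HIndex HIndex ℝ,
      k = fromBlocks !![-g.det, 0; 0, 1] 0 !![0, 0; R + 1, 0] !![0, 1; 1, 0] := ⟨_, rfl⟩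
  -- The last row is the new plane at infinity, the others make `det k = det g`.
  have hkdet : k.det = g.det := by
    rw [hk, det_fromBlocks_zero₁₂, det_fin_two_of, det_fin_two_of]; ring
  have hmem : ∀ t, (k, γ t) ∈ charts := fun t => by
    refine ⟨by rw [hkdet]; exact hc.1, (hγ t).1, (hγ t).2, fun i h => ?_⟩
    have h0 := congrFun h 0
    have := abs_le.1 (hR' t)
    fin_cases i <;> simp [mul_apply, hk, normalLine] at h0 <;> linarith
  have hpath : JoinedIn charts (k, M) (k, M') :=
    ⟨(Path.refl k).prod γ, hmem⟩
  have hg := mul_self_pos.2 hc.1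
  refine ((joinedIn_charts_same hc hpath.source_mem ?_).trans hpath).trans
    (joinedIn_charts_same hpath.target_mem hc' ?_) <;> rw [hkdet] <;> assumption

/-! ### The positions of the fourth line -/

theorem det_smul_one_add {K : Matrix (Fin 2) (Fin 2) ℝ} (hK : K.trace = 0) (y s : ℝ) :
    (y • (1 : Matrix (Fin 2) (Fin 2) ℝ) + s • K).det = y ^ 2 + s ^ 2 * K.det := by
  rw [trace_fin_two] at hK
  simp only [det_fin_two, Matrix.add_apply, Matrix.smul_apply, one_apply_eq, smul_eq_mul,
    one_apply_ne (zero_ne_one (α := Fin 2)), one_apply_ne (one_ne_zero (α := Fin 2))]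
  linear_combination y * s * hK

theorem smul_one_add_mem_iff {K : Matrix (Fin 2) (Fin 2) ℝ} (hK : K.trace = 0) (y s : ℝ) :
    y • (1 : Matrix (Fin 2) (Fin 2) ℝ) + s • K ∈
        {N : Matrix (Fin 2) (Fin 2) ℝ | N.det ≠ 0 ∧ (N - 1).det ≠ 0} ↔
      y ^ 2 + s ^ 2 * K.det ≠ 0 ∧ (y - 1) ^ 2 + s ^ 2 * K.det ≠ 0 := by
  rw [Set.mem_ofPred_eq, det_smul_one_add hK, ← det_smul_one_add hK (y - 1) s]
  rw [show y • (1 : Matrix (Fin 2) (Fin 2) ℝ) + s • K - 1 =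
    (y - 1) • (1 : Matrix (Fin 2) (Fin 2) ℝ) + s • K by module]

/-- A matrix with complex eigenvalues is connected to `-1`. -/
theorem joinedIn_neg_one_of_det_pos {K : Matrix (Fin 2) (Fin 2) ℝ} (hK : K.trace = 0)
    (hdet : 0 < K.det) (y : ℝ) :
    JoinedIn {N : Matrix (Fin 2) (Fin 2) ℝ | N.det ≠ 0 ∧ (N - 1).det ≠ 0}
      (y • (1 : Matrix (Fin 2) (Fin 2) ℝ) + (1 : ℝ) • K) (-1) := by
  have h1 : JoinedIn {N : Matrix (Fin 2) (Fin 2) ℝ | N.det ≠ 0 ∧ (N - 1).det ≠ 0}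
      (y • (1 : Matrix (Fin 2) (Fin 2) ℝ) + (1 : ℝ) • K)
      ((-1 : ℝ) • (1 : Matrix (Fin 2) (Fin 2) ℝ) + (1 : ℝ) • K) := by
    refine joinedIn_of_segment fun θ _ _ => ?_
    rw [show y • (1 : Matrix (Fin 2) (Fin 2) ℝ) + (1 : ℝ) • K +
      θ • ((-1 : ℝ) • (1 : Matrix (Fin 2) (Fin 2) ℝ) + (1 : ℝ) • K -
        (y • (1 : Matrix (Fin 2) (Fin 2) ℝ) + (1 : ℝ) • K)) =
      (y + θ * (-1 - y)) • (1 : Matrix (Fin 2) (Fin 2) ℝ) + (1 : ℝ) • K by module,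
      smul_one_add_mem_iff hK]
    constructor <;> positivity
  refine h1.trans (joinedIn_of_segment fun θ _ _ => ?_)
  rw [show (-1 : ℝ) • (1 : Matrix (Fin 2) (Fin 2) ℝ) + (1 : ℝ) • K +
    θ • (-1 - ((-1 : ℝ) • (1 : Matrix (Fin 2) (Fin 2) ℝ) + (1 : ℝ) • K)) =
    (-1 : ℝ) • (1 : Matrix (Fin 2) (Fin 2) ℝ) + (1 - θ) • K by module,
    smul_one_add_mem_iff hK]
  constructor <;> positivity

/-- If the eigenvalues are complex or lie in the same component of `ℝ ∖ {0, 1}`, then the matrix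
is connected to `-1`: it can be shrunk to a scalar matrix unless its eigenvalues are complex, and
then passes through the complex region. -/
theorem joinedIn_neg_one {N : Matrix (Fin 2) (Fin 2) ℝ} (h0 : 0 < N.det) (h1 : 0 < (N - 1).det) :
    JoinedIn {N : Matrix (Fin 2) (Fin 2) ℝ | N.det ≠ 0 ∧ (N - 1).det ≠ 0} N (-1) := by
  obtain ⟨x, hx⟩ : ∃ x, x = N.trace / 2 := ⟨_, rfl⟩
  obtain ⟨K, hKdef⟩ : ∃ K, K = N - x • (1 : Matrix (Fin 2) (Fin 2) ℝ) := ⟨_, rfl⟩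
  have hK : K.trace = 0 := by
    rw [hKdef, trace_sub, trace_smul, trace_one, hx]; simp
  obtain rfl : N = x • (1 : Matrix (Fin 2) (Fin 2) ℝ) + (1 : ℝ) • K := by rw [hKdef]; module
  clear hx hKdef
  rw [show x • (1 : Matrix (Fin 2) (Fin 2) ℝ) + (1 : ℝ) • K - 1 =
    (x - 1) • (1 : Matrix (Fin 2) (Fin 2) ℝ) + (1 : ℝ) • K by module] at h1
  rw [det_smul_one_add hK] at h0 h1
  rcases lt_or_ge 0 K.det with h | h
  · exact joinedIn_neg_one_of_det_pos hK h x
  have hx0 : 0 < x ^ 2 := by linarith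
  have hx1 : 0 < (x - 1) ^ 2 := by linarith
  set J : Matrix (Fin 2) (Fin 2) ℝ := !![0, -1; 1, 0] with hJdef
  have hJ : J.trace = 0 := by simp [hJdef, trace_fin_two]
  have hJdet : J.det = 1 := by simp [hJdef, det_fin_two]
  have hA : JoinedIn {N : Matrix (Fin 2) (Fin 2) ℝ | N.det ≠ 0 ∧ (N - 1).det ≠ 0}
      (x • (1 : Matrix (Fin 2) (Fin 2) ℝ) + (1 : ℝ) • K)
      (x • (1 : Matrix (Fin 2) (Fin 2) ℝ) + (0 : ℝ) • J) := by
    refine joinedIn_of_segment fun θ hθ0 hθ1 => ?_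
    rw [show x • (1 : Matrix (Fin 2) (Fin 2) ℝ) + (1 : ℝ) • K +
      θ • (x • (1 : Matrix (Fin 2) (Fin 2) ℝ) + (0 : ℝ) • J -
        (x • (1 : Matrix (Fin 2) (Fin 2) ℝ) + (1 : ℝ) • K)) =
      x • (1 : Matrix (Fin 2) (Fin 2) ℝ) + (1 - θ) • K by module, smul_one_add_mem_iff hK]
    have h2 : K.det ≤ (1 - θ) ^ 2 * K.det := by
      have : (1 - θ) ^ 2 ≤ 1 := by nlinarith
      nlinarith
    constructor <;> apply ne_of_gt <;> linarith
  have hB : JoinedIn {N : Matrix (Fin 2) (Fin 2) ℝ | N.det ≠ 0 ∧ (N - 1).det ≠ 0}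
      (x • (1 : Matrix (Fin 2) (Fin 2) ℝ) + (0 : ℝ) • J)
      (x • (1 : Matrix (Fin 2) (Fin 2) ℝ) + (1 : ℝ) • J) := by
    refine joinedIn_of_segment fun θ hθ0 hθ1 => ?_
    rw [show x • (1 : Matrix (Fin 2) (Fin 2) ℝ) + (0 : ℝ) • J +
      θ • (x • (1 : Matrix (Fin 2) (Fin 2) ℝ) + (1 : ℝ) • J -
        (x • (1 : Matrix (Fin 2) (Fin 2) ℝ) + (0 : ℝ) • J)) =
      x • (1 : Matrix (Fin 2) (Fin 2) ℝ) + θ • J by module, smul_one_add_mem_iff hJ, hJdet]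
    constructor <;> positivity
  exact (hA.trans hB).trans (joinedIn_neg_one_of_det_pos hJ (by rw [hJdet]; exact one_pos) x)

/-- If `det N > 0` and `det (N - 1) < 0`, then the eigenvalues of `N` are real and separated by
`1`, and so `N` can be diagonalized. -/
theorem exists_diagonalization {N : Matrix (Fin 2) (Fin 2) ℝ} (h0 : 0 < N.det)
    (h1 : (N - 1).det < 0) : ∃ (k : Matrix (Fin 2) (Fin 2) ℝ) (a b : ℝ), k.det ≠ 0 ∧ 1 < a ∧
      0 < b ∧ b < 1 ∧ N * k = k * diagonal ![a, b] := by
  have hchar : ∀ t : ℝ, (N - t • (1 : Matrix (Fin 2) (Fin 2) ℝ)).det =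
      t ^ 2 - N.trace * t + N.det := fun t => by
    simp [det_fin_two, trace_fin_two]; ring
  have h1' := hchar 1
  rw [one_smul] at h1'
  set τ := N.trace
  set δ := N.det
  have hdisc : 0 < τ ^ 2 - 4 * δ := by nlinarith [sq_nonneg (δ - 1)]
  set r := √(τ ^ 2 - 4 * δ)
  have hr : r ^ 2 = τ ^ 2 - 4 * δ := Real.sq_sqrt hdisc.le
  have hr0 : 0 < r := Real.sqrt_pos.2 hdisc
  set a := (τ + r) / 2 with ha
  set b := (τ - r) / 2 with hb
  have hab : a * b = δ := by rw [ha, hb]; linear_combination -hr / 4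
  have hprod : (a - 1) * (b - 1) < 0 := by
    rw [show (a - 1) * (b - 1) = a * b - τ + 1 by rw [ha, hb]; ring, hab]; linarith
  have hlt : b < a := by rw [ha, hb]; linarith
  have ha1 : 1 < a := by nlinarith
  have hb1 : b < 1 := by nlinarith
  have hb0 : 0 < b := by nlinarith
  have eig : ∀ t : ℝ, t ^ 2 - τ * t + δ = 0 → ∃ v ≠ 0, N *ᵥ v = t • v := fun t ht => by
    rw [← hchar] at ht
    obtain ⟨v, hv, hv'⟩ := exists_mulVec_eq_zero_iff.2 ht
    refine ⟨v, hv, ?_⟩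
    rwa [sub_mulVec, smul_mulVec, one_mulVec, sub_eq_zero] at hv'
  obtain ⟨v, hv, hNv⟩ := eig a (by rw [ha]; linear_combination hr / 4)
  obtain ⟨w, hw, hNw⟩ := eig b (by rw [hb]; linear_combination hr / 4)
  refine ⟨!![v 0, w 0; v 1, w 1], a, b, fun hdet => ?_, ha1, hb0, hb1, ?_⟩
  · obtain ⟨c, hc, hc'⟩ := exists_mulVec_eq_zero_iff.2 hdet
    have hlin : c 0 • v + c 1 • w = 0 := by
      ext i
      have := congrFun hc' i
      fin_cases i <;> simp [mulVec, dotProduct] at this ⊢ <;> linarith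
    have hN := congrArg (N *ᵥ ·) hlin
    simp only [mulVec_add, mulVec_smul, hNv, hNw, mulVec_zero] at hN
    have h3 : (c 0 * (a - b)) • v = 0 := by
      have := congrArg (fun z => b • z) hlin
      simp only [smul_zero] at this
      rw [← sub_eq_zero.2 (hN.trans this.symm)]
      module
    have h4 : c 0 = 0 := by
      rcases mul_eq_zero.1 ((smul_eq_zero.1 h3).resolve_right hv) with h | h
      · exact h
      · linarith
    rw [h4, zero_smul, zero_add, smul_eq_zero] at hlin
    exact hc (funext fun i => by fin_cases i; exacts [h4, hlin.resolve_right hw])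
  · have hv' := fun i => congrFun hNv i
    have hw' := fun i => congrFun hNw i
    simp only [mulVec, dotProduct, Fin.sum_univ_two, Pi.smul_apply, smul_eq_mul] at hv' hw'
    ext i j
    fin_cases j <;> simp [mul_apply, Fin.sum_univ_two, hv', hw'] <;> fin_cases i <;> simp <;> ring

theorem joinedIn_diagonal {a b a' b' : ℝ} (ha : 1 < a) (hb : 0 < b) (hb1 : b < 1) (ha' : 1 < a')
    (hb' : 0 < b') (hb1' : b' < 1) :
    JoinedIn {N : Matrix (Fin 2) (Fin 2) ℝ | N.det ≠ 0 ∧ (N - 1).det ≠ 0}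
      (diagonal ![a, b]) (diagonal ![a', b']) := by
  refine joinedIn_of_segment fun θ h0 h1 => ?_
  have conv : ∀ {c x y : ℝ}, c < x → c < y → c < x + θ * (y - x) := fun {c x y} hx hy => by
    rcases h0.eq_or_lt with h | h
    · rw [← h]; linarith
    · nlinarith [mul_nonneg (sub_nonneg.2 h1) (sub_nonneg.2 hx.le), mul_pos h (sub_pos.2 hy)]
  have e1 := conv ha ha'
  have e2 := conv hb hb'
  have e3 := conv (neg_lt_neg hb1) (neg_lt_neg hb1')
  constructor
  · simp [det_fin_two]
    constructor <;> apply ne_of_gt <;> linarith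
  · simp [det_fin_two]
    constructor
    · apply ne_of_gt; linarith
    · apply ne_of_lt; linarith

/-- A basis change of `ℝ²`, applied to both summands of `ℝ² ⊕ ℝ²`, conjugates the matrix of the
fourth line and changes none of the lines. -/
theorem chart_conj {g : Matrix HIndex HIndex ℝ} {M M' k : Matrix (Fin 2) (Fin 2) ℝ}
    (hc : (g, M) ∈ charts) (hk : k.det ≠ 0) (hM : M * k = k * M') :
    ∃ g', (g', M') ∈ charts ∧ 0 < g.det * g'.det ∧
      ∀ i, lineThrough ((chartFrame (g', M')).1 i) ((chartFrame (g', M')).2 i) =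
        lineThrough ((chartFrame (g, M)).1 i) ((chartFrame (g, M)).2 i) := by
  have hi : ∀ i, g * (fromBlocks k 0 0 k : Matrix HIndex HIndex ℝ) * normalLine M' i =
      g * normalLine M i * k := fun i => by
    rw [Matrix.mul_assoc, Matrix.mul_assoc]
    congr 1
    fin_cases i <;> simp [normalLine, fromBlocks_mul_fromRows, fromRows_mul, hM]
  have hdet : M'.det = M.det := by
    have := congrArg det hM
    rw [det_mul, det_mul, mul_comm] at this
    exact (mul_left_cancel₀ hk this).symm
  have hdet1 : (M' - 1).det = (M - 1).det := by
    have : (M - 1) * k = k * (M' - 1) := by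
      rw [Matrix.sub_mul, Matrix.mul_sub, hM, Matrix.one_mul, Matrix.mul_one]
    have := congrArg det this
    rw [det_mul, det_mul, mul_comm] at this
    exact (mul_left_cancel₀ hk this).symm
  have hg : (g * (fromBlocks k 0 0 k : Matrix HIndex HIndex ℝ)).det = g.det * k.det ^ 2 := by
    rw [det_mul, det_fromBlocks_zero₂₁, sq]
  have hg0 := hc.1
  refine ⟨g * (fromBlocks k 0 0 k : Matrix HIndex HIndex ℝ), ⟨?_, ?_, ?_, fun i => ?_⟩, ?_,
    fun i => ?_⟩
  · rw [hg]; exact mul_ne_zero hg0 (pow_ne_zero 2 hk)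
  · rw [hdet]; exact hc.2.1
  · rw [hdet1]; exact hc.2.2.1
  · simp only [hi]
    exact mul_apply_ne_zero hk (hc.2.2.2 i)
  · dsimp only at hg0
    rw [hg, ← mul_assoc, ← sq]; positivity
  · change lineOf (g * (fromBlocks k 0 0 k : Matrix HIndex HIndex ℝ) * normalLine M' i) = _
    rw [hi, lineOf_mul (hc.2.2.2 i) hk]
    rfl

/-! ### Classification by linking numbers -/

theorem isotopic_of_joinedIn {n : ℕ} {A B : Interlacing n} {x y : (Fin n → Space) × (Fin n → Space)}
    (h : JoinedIn (frames n) x y) (hA : frameLines x = A.lines) (hB : frameLines y = B.lines) :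
    Isotopic A B :=
  (isotopic_iff A B).2 ⟨x, y, h, hA, hB⟩

theorem frameLines_congr {n : ℕ} {x y : (Fin n → Space) × (Fin n → Space)}
    (h : ∀ i, lineThrough (x.1 i) (x.2 i) = lineThrough (y.1 i) (y.2 i)) :
    frameLines x = frameLines y := by
  simp only [frameLines, h]

theorem exists_chart_of_frame {x : (Fin 4 → Space) × (Fin 4 → Space)} (hx : x ∈ frames 4) :
    ∃ c ∈ charts, frameLines (chartFrame c) = frameLines x ∧
      ∀ i j k, tripleSign (chartFrame c) i j k = tripleSign x i j k := by
  obtain ⟨c, hc, h⟩ := exists_chart hx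
  refine ⟨c, hc, frameLines_congr h, fun i j k => ?_⟩
  have h1 := tripleLinking_tripleSign (chartFrame_mem_frames hc) i j k
  rw [h, h, h] at h1
  exact h1.unique (tripleLinking_tripleSign hx i j k)

theorem tripleSign_chartFrame {c : Matrix HIndex HIndex ℝ × Matrix (Fin 2) (Fin 2) ℝ}
    (hc : c ∈ charts) :
    tripleSign (chartFrame c) 0 1 2 = -SignType.sign c.1.det ∧
    tripleSign (chartFrame c) 0 1 3 = -SignType.sign c.1.det * SignType.sign c.2.det ∧
    tripleSign (chartFrame c) 1 2 3 = -SignType.sign c.1.det * SignType.sign (c.2 - 1).det := by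
  obtain ⟨h01, h02, h03, h12, h13, h23⟩ := det_normalLine c.2
  have hs : SignType.sign c.1.det ≠ 0 := sign_ne_zero.2 hc.1
  simp only [tripleSign, pairLinking_eq_sign, linkDet_chartFrame hc, h01, h02, h03, h12, h13, h23,
    mul_one, Left.sign_neg, sign_mul]
  generalize SignType.sign c.1.det = s at *
  generalize SignType.sign c.2.det = m
  generalize SignType.sign (c.2 - 1).det = n
  revert s m n
  decide

/-- Interlacings all of whose triples have the same linking number `ε` are isotopic. -/
theorem isotopic_of_isUniform {ε : SignType} {A B : Interlacing 4} (hA : A.IsUniform ε)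
    (hB : B.IsUniform ε) : Isotopic A B := by
  have key : ∀ C : Interlacing 4, C.IsUniform ε → ∃ g M, (g, M) ∈ charts ∧
      frameLines (chartFrame (g, M)) = C.lines ∧ SignType.sign g.det = -ε ∧ 0 < M.det ∧
      0 < (M - 1).det := by
    intro C hC
    obtain ⟨x, hx, hxC⟩ := exists_frame C
    obtain ⟨⟨g, M⟩, hc, hl, ht⟩ := exists_chart_of_frame hx
    have hu := (isUniform_iff hx hxC ε).1 hC
    obtain ⟨h1, h2, h3⟩ := tripleSign_chartFrame hc
    rw [ht, hu _ _ _ (by decide) (by decide) (by decide)] at h1 h2 h3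
    have hs : SignType.sign g.det ≠ 0 := sign_ne_zero.2 hc.1
    refine ⟨g, M, hc, hl.trans hxC, by rw [h1, neg_neg], sign_eq_one_iff.1 ?_,
      sign_eq_one_iff.1 ?_⟩
    · rw [h1] at h2
      generalize SignType.sign g.det = s at *
      generalize SignType.sign M.det = m at *
      clear h1 h3; revert s m; decide
    · rw [h1] at h3
      generalize SignType.sign g.det = s at *
      generalize SignType.sign (M - 1).det = m at *
      clear h1 h2; revert s m; decide
  obtain ⟨g, M, hc, hl, hs, h0, h1⟩ := key A hA
  obtain ⟨g', M', hc', hl', hs', h0', h1'⟩ := key B hB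
  refine isotopic_of_joinedIn (joinedIn_chartFrame (joinedIn_charts hc hc' ?_
    ((joinedIn_neg_one h0 h1).trans (joinedIn_neg_one h0' h1').symm))) hl hl'
  have hs0 : SignType.sign g.det ≠ 0 := sign_ne_zero.2 hc.1
  rw [← sign_eq_one_iff, sign_mul, hs', ← hs]
  generalize SignType.sign g.det = s at *
  clear hs; revert s; decide

/-- The symmetric matrix of the linking numbers of four oriented lines. -/
def signMatrix (a b c d e f : SignType) : Fin 4 → Fin 4 → SignType :=
  ![![0, a, b, c], ![a, 0, d, e], ![b, d, 0, f], ![c, e, f, 0]]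

/-- The linking number of a triple, computed from those of the pairs. -/
def signTriple (E : Fin 4 → Fin 4 → SignType) (i j k : Fin 4) : SignType :=
  E i j * E j k * E i k

set_option synthInstance.maxHeartbeats 400000 in
set_option synthInstance.maxSize 1000 in
set_option maxRecDepth 100000 in
/-- The product of the linking numbers of the four triples is `1`, since each pair enters it twice.
Hence two of them are `1` and two are `-1` unless all are equal. -/
theorem exists_mixed_order : ∀ a b c d e f : SignType, a ≠ 0 → b ≠ 0 → c ≠ 0 → d ≠ 0 →
    e ≠ 0 → f ≠ 0 →
    (¬ ∀ i j k, i ≠ j → j ≠ k → i ≠ k → signTriple (signMatrix a b c d e f) i j k = 1) →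
    (¬ ∀ i j k, i ≠ j → j ≠ k → i ≠ k → signTriple (signMatrix a b c d e f) i j k = -1) →
    ∃ i j k l : Fin 4, Function.Injective ![i, j, k, l] ∧
      signTriple (signMatrix a b c d e f) i j k = 1 ∧
      signTriple (signMatrix a b c d e f) i j l = 1 ∧
      signTriple (signMatrix a b c d e f) j k l = -1 := by
  decide

theorem exists_mixed_frame {A : Interlacing 4} (h1 : ¬ A.IsUniform 1) (h2 : ¬ A.IsUniform (-1)) :
    ∃ x ∈ frames 4, frameLines x = A.lines ∧ tripleSign x 0 1 2 = 1 ∧ tripleSign x 0 1 3 = 1 ∧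
      tripleSign x 1 2 3 = -1 := by
  obtain ⟨x, hx, hxA⟩ := exists_frame A
  rw [isUniform_iff hx hxA] at h1 h2
  set E : Fin 4 → Fin 4 → SignType := fun i j => pairLinking (x.1 i) (x.2 i) (x.1 j) (x.2 j)
    with hE
  have hE0 : ∀ i j, i ≠ j → E i j ≠ 0 := fun i j hij =>
    sign_ne_zero.2 (linkDet_ne_zero_of_mem_frames hx hij)
  have hsymm : ∀ i j, E i j = E j i := fun i j => by
    simp only [hE, pairLinking_eq_sign]
    rw [linkDet_comm]
  have hmat : ∀ i j, i ≠ j → E i j =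
      signMatrix (E 0 1) (E 0 2) (E 0 3) (E 1 2) (E 1 3) (E 2 3) i j := by
    intro i j hij
    fin_cases i <;> fin_cases j <;> first | exact absurd rfl hij | rfl | exact hsymm _ _
  have htrip : ∀ i j k, i ≠ j → j ≠ k → i ≠ k → tripleSign x i j k =
      signTriple (signMatrix (E 0 1) (E 0 2) (E 0 3) (E 1 2) (E 1 3) (E 2 3)) i j k := by
    intro i j k hij hjk hik
    change E i j * E j k * E i k = _
    rw [signTriple, hmat i j hij, hmat j k hjk, hmat i k hik]
  obtain ⟨i, j, k, l, hinj, e1, e2, e3⟩ := exists_mixed_order (E 0 1) (E 0 2) (E 0 3) (E 1 2)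
    (E 1 3) (E 2 3) (hE0 _ _ (by decide)) (hE0 _ _ (by decide)) (hE0 _ _ (by decide))
    (hE0 _ _ (by decide)) (hE0 _ _ (by decide)) (hE0 _ _ (by decide))
    (fun h => h1 fun i j k hij hjk hik => (htrip i j k hij hjk hik).trans (h i j k hij hjk hik))
    (fun h => h2 fun i j k hij hjk hik => (htrip i j k hij hjk hik).trans (h i j k hij hjk hik))
  have hij : i ≠ j := hinj.ne (a₁ := 0) (a₂ := 1) (by decide)
  have hik : i ≠ k := hinj.ne (a₁ := 0) (a₂ := 2) (by decide)
  have hil : i ≠ l := hinj.ne (a₁ := 0) (a₂ := 3) (by decide)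
  have hjk : j ≠ k := hinj.ne (a₁ := 1) (a₂ := 2) (by decide)
  have hjl : j ≠ l := hinj.ne (a₁ := 1) (a₂ := 3) (by decide)
  have hkl : k ≠ l := hinj.ne (a₁ := 2) (a₂ := 3) (by decide)
  have hsurj := Finite.injective_iff_surjective.1 hinj
  refine ⟨(x.1 ∘ ![i, j, k, l], x.2 ∘ ![i, j, k, l]), ⟨fun a => hx.1 _, fun a b hab =>
    hx.2 (hinj.ne hab)⟩, ?_, ?_, ?_, ?_⟩
  · rw [← hxA]
    exact hsurj.range_comp fun a => lineThrough (x.1 a) (x.2 a)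
  · exact (htrip i j k hij hjk hik).trans e1
  · exact (htrip i j l hij hjl hil).trans e2
  · exact (htrip j k l hjk hkl hjl).trans e3

/-- All interlacings of four lines with triples of both linking numbers are isotopic. -/
theorem isotopic_of_not_isUniform {A B : Interlacing 4} (hA : ¬ A.IsUniform 1)
    (hA' : ¬ A.IsUniform (-1)) (hB : ¬ B.IsUniform 1) (hB' : ¬ B.IsUniform (-1)) :
    Isotopic A B := by
  have key : ∀ C : Interlacing 4, ¬ C.IsUniform 1 → ¬ C.IsUniform (-1) → ∃ g a b,
      (g, diagonal ![a, b]) ∈ charts ∧ frameLines (chartFrame (g, diagonal ![a, b])) = C.lines ∧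
      g.det < 0 ∧ 1 < a ∧ 0 < b ∧ b < 1 := by
    intro C hC hC'
    obtain ⟨x, hx, hxC, hx1, hx2, hx3⟩ := exists_mixed_frame hC hC'
    obtain ⟨⟨g, M⟩, hc, hl, ht⟩ := exists_chart_of_frame hx
    obtain ⟨h1, h2, h3⟩ := tripleSign_chartFrame hc
    dsimp only at h1 h2 h3
    rw [ht, hx1] at h1
    have hg : SignType.sign g.det = -1 := by
      clear h2 h3
      generalize SignType.sign g.det = s at *
      revert s; decide
    rw [ht, hg, neg_neg, one_mul] at h2 h3
    obtain ⟨k, a, b, hk, ha, hb, hb1, hM⟩ := exists_diagonalization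
      (sign_eq_one_iff.1 (h2.symm.trans hx2)) (sign_eq_neg_one_iff.1 (h3.symm.trans hx3))
    obtain ⟨g', hc', hgg, hl'⟩ := chart_conj hc hk hM
    refine ⟨g', a, b, hc', ((frameLines_congr hl').trans hl).trans hxC, ?_, ha, hb, hb1⟩
    exact neg_of_mul_pos_right hgg (sign_eq_neg_one_iff.1 hg).le
  obtain ⟨g, a, b, hc, hl, hg, ha, hb, hb1⟩ := key A hA hA'
  obtain ⟨g', a', b', hc', hl', hg', ha', hb', hb1'⟩ := key B hB hB'
  exact isotopic_of_joinedIn (joinedIn_chartFrame (joinedIn_charts hc hc'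
    (mul_pos_of_neg_of_neg hg hg') (joinedIn_diagonal ha hb hb1 ha' hb' hb1'))) hl hl'

theorem not_isUniform_neg_one_of_isUniform_one {A : Interlacing 4} (h : A.IsUniform 1) :
    ¬ A.IsUniform (-1) := by
  intro h'
  obtain ⟨x, hx, hxA⟩ := exists_frame A
  have h1 := (isUniform_iff hx hxA 1).1 h 0 1 2 (by decide) (by decide) (by decide)
  have h2 := (isUniform_iff hx hxA (-1)).1 h' 0 1 2 (by decide) (by decide) (by decide)
  exact absurd (h1.symm.trans h2) (by decide)

/-! ### Generatrices of hyperboloids -/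

/-- The frame of the four generatrices of `x₀² + x₁² - x₂² = 1` through `(±1, 0, 0)` and
`(0, ±1, 0)`; they belong to one or the other family according to the sign of `e = ±1`. -/
noncomputable def rulingFrame (e : ℝ) : (Fin 4 → Space) × (Fin 4 → Space) :=
  (fun i => !₂[(![1, 0, -1, 0] : Fin 4 → ℝ) i, (![0, 1, 0, -1] : Fin 4 → ℝ) i, 0],
    fun i => !₂[-(![0, 1, 0, -1] : Fin 4 → ℝ) i, (![1, 0, -1, 0] : Fin 4 → ℝ) i, e])

theorem sign_linkDet_rulingFrame (e : ℝ) {i j : Fin 4} (hij : i ≠ j) :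
    SignType.sign (linkDet ((rulingFrame e).1 i) ((rulingFrame e).2 i) ((rulingFrame e).1 j)
      ((rulingFrame e).2 j)) = SignType.sign e := by
  have h : linkDet ((rulingFrame e).1 i) ((rulingFrame e).2 i) ((rulingFrame e).1 j)
      ((rulingFrame e).2 j) =
      e * (((![1, 0, -1, 0] : Fin 4 → ℝ) i - (![1, 0, -1, 0] : Fin 4 → ℝ) j) ^ 2 +
        ((![0, 1, 0, -1] : Fin 4 → ℝ) i - (![0, 1, 0, -1] : Fin 4 → ℝ) j) ^ 2) := by
    simp [linkDet_eq, rulingFrame]; ring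
  have hpos : 0 < ((![1, 0, -1, 0] : Fin 4 → ℝ) i - (![1, 0, -1, 0] : Fin 4 → ℝ) j) ^ 2 +
      ((![0, 1, 0, -1] : Fin 4 → ℝ) i - (![0, 1, 0, -1] : Fin 4 → ℝ) j) ^ 2 := by
    fin_cases i <;> fin_cases j <;> first | exact absurd rfl hij | norm_num
  rw [h, sign_mul, sign_pos hpos, mul_one]

theorem rulingFrame_mem_frames {e : ℝ} (he : e ≠ 0) : rulingFrame e ∈ frames 4 := by
  rw [mem_frames_iff]
  intro i j hij
  rw [← sign_ne_zero, sign_linkDet_rulingFrame e hij]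
  exact sign_ne_zero.2 he

theorem exists_isHyperboloidal {e : ℝ} (he : e ^ 2 = 1) :
    ∃ A : Interlacing 4, IsHyperboloidal (SignType.sign e) A := by
  have he0 : e ≠ 0 := by rintro rfl; norm_num at he
  have hx := rulingFrame_mem_frames he0
  refine ⟨Interlacing.ofFrame _ hx, ⟨AffineEquiv.refl ℝ Space, ?_⟩, ?_⟩
  · intro l hl y hy
    rw [← Finset.mem_coe, Interlacing.coe_lines_ofFrame] at hl
    obtain ⟨i, rfl⟩ := hl
    obtain ⟨s, rfl⟩ := mem_lineThrough.1 hy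
    refine ⟨_, ?_, rfl⟩
    fin_cases i <;> simp [rulingFrame] <;> linear_combination (-s ^ 2) * he
  · refine (isUniform_iff hx (Interlacing.coe_lines_ofFrame _ hx).symm _).2 ?_
    intro i j k hij hjk hik
    simp only [tripleSign, pairLinking_eq_sign, sign_linkDet_rulingFrame e hij,
      sign_linkDet_rulingFrame e hjk, sign_linkDet_rulingFrame e hik]
    have := sign_ne_zero.2 he0
    generalize SignType.sign e = s at *
    revert s; decide

/-- The affine map that takes the vertical axis to the horizontal line `(ℝ, 3, 0)`. -/
noncomputable def turnAndShift : Space ≃ᵃ[ℝ] Space :=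
  (LinearIsometryEquiv.piLpCongrLeft 2 ℝ ℝ (finRotate 3)).toLinearEquiv.toAffineEquiv.trans
    (AffineEquiv.constVAdd ℝ Space !₂[0, 3, 0])

theorem turnAndShift_apply (x : Space) : turnAndShift x = !₂[x 2, x 0 + 3, x 1] := by
  ext i
  have h : ∀ i, turnAndShift x i = (!₂[0, 3, 0] : Space) i + x ((finRotate 3).symm i) :=
    fun i => rfl
  rw [h]
  fin_cases i
  · exact zero_add _
  · exact add_comm _ _
  · exact zero_add _

theorem turnAndShift_linear_apply (x : Space) : turnAndShift.linear x = !₂[x 2, x 0, x 1] := by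
  have h := turnAndShift.map_vadd 0 x
  rw [vadd_eq_add, add_zero, vadd_eq_add, turnAndShift_apply, turnAndShift_apply] at h
  rw [← sub_eq_iff_eq_add.2 h]
  ext i
  fin_cases i <;> simp

/-- Two generatrices of `x₀² + x₁² - x₂² = 1`, and two generatrices, of the family with the opposite
linking number, of a copy of this hyperboloid with a horizontal axis. -/
noncomputable def pairsFrame : (Fin 4 → Space) × (Fin 4 → Space) :=
  (![!₂[1, 0, 0], !₂[-1, 0, 0], !₂[0, 4, 0], !₂[0, 2, 0]],
    ![!₂[0, 1, 1], !₂[0, -1, 1], !₂[-1, 0, 1], !₂[-1, 0, -1]])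

theorem exists_isPairOfPairs : ∃ A : Interlacing 4, IsPairOfPairs 1 (-1) A := by
  have hx : pairsFrame ∈ frames 4 := by
    rw [mem_frames_iff]
    intro i j hij
    fin_cases i <;> fin_cases j <;>
      first | exact absurd rfl hij | (simp [linkDet_eq, pairsFrame]; try norm_num)
  have hg : ∀ x : Space, (x 1 - 3) ^ 2 + x 2 ^ 2 - x 0 ^ 2 = 1 → x ∈ hyperboloid turnAndShift := by
    intro x h
    refine ⟨!₂[x 1 - 3, x 2, x 0], by simpa using h, ?_⟩
    rw [turnAndShift_apply]
    ext i
    fin_cases i <;> simp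
  refine ⟨Interlacing.ofFrame _ hx, AffineEquiv.refl ℝ Space, turnAndShift, ?_, ?_,
    lineThrough (pairsFrame.1 0) (pairsFrame.2 0), lineThrough (pairsFrame.1 1) (pairsFrame.2 1),
    lineThrough (pairsFrame.1 2) (pairsFrame.2 2), lineThrough (pairsFrame.1 3) (pairsFrame.2 3),
    ?_, ?_, ?_, ?_, ?_, ?_, ?_, ?_, ?_⟩
  · rw [Set.disjoint_left]
    rintro _ ⟨x, hx, rfl⟩ ⟨y, hy, hxy⟩
    rw [turnAndShift_apply] at hxy
    have h0 := congrArg (fun z : Space => z 0) hxy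
    have h1 := congrArg (fun z : Space => z 1) hxy
    have h2 := congrArg (fun z : Space => z 2) hxy
    simp at h0 h1 h2 hx hy
    rw [← h0, ← h1, ← h2] at hx
    -- Adding the inequalities gives `y₀² + (y₀ + 3)² ≤ 2`, but the left side is at least `9/2`.
    nlinarith [sq_nonneg (2 * y 0 + 3)]
  · rw [hyperboloidAxis, hyperboloidAxis, lineThrough_map, lineThrough_map,
      turnAndShift_linear_apply, turnAndShift_apply, skew_lineThrough_iff]
    · simp [linkDet_eq]
    · simp
    · intro h
      simpa using congrArg (fun z : Space => z 0) h
  · rw [Interlacing.coe_lines_ofFrame]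
    ext l
    simp [frameLines, Fin.exists_fin_succ, eq_comm]
  · intro y hy
    obtain ⟨s, rfl⟩ := mem_lineThrough.1 hy
    exact ⟨_, by simp [pairsFrame], rfl⟩
  · intro y hy
    obtain ⟨s, rfl⟩ := mem_lineThrough.1 hy
    exact ⟨_, by simp [pairsFrame], rfl⟩
  · intro y hy
    obtain ⟨s, rfl⟩ := mem_lineThrough.1 hy
    exact hg _ (by simp [pairsFrame]; norm_num)
  · intro y hy
    obtain ⟨s, rfl⟩ := mem_lineThrough.1 hy
    exact hg _ (by simp [pairsFrame]; norm_num)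
  all_goals
    refine ⟨_, _, _, _, _, _, hx.1 _, hx.1 _, hx.1 _, rfl, rfl, rfl, ?_⟩
    rw [pairLinking_eq_sign, pairLinking_eq_sign, pairLinking_eq_sign, ← sign_mul, ← sign_mul]
    first | refine sign_eq_one_iff.2 ?_ | refine sign_eq_neg_one_iff.2 ?_
    simp [linkDet_eq, pairsFrame]
    try norm_num

theorem IsPairOfPairs.not_isUniform {A : Interlacing 4} (h : IsPairOfPairs 1 (-1) A) :
    ¬ A.IsUniform 1 ∧ ¬ A.IsUniform (-1) := by
  obtain ⟨f, g, -, -, a, b, c, d, hA, -, -, -, -, habc, -, hcda, -⟩ := h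
  classical
  have hA' : A.lines = {a, b, c, d} := by
    apply Finset.coe_injective
    rw [hA]; simp
  have hcard := A.card_lines
  have hne : a ≠ b ∧ a ≠ c ∧ a ≠ d ∧ b ≠ c ∧ b ≠ d ∧ c ≠ d := by
    rw [hA'] at hcard
    refine ⟨?_, ?_, ?_, ?_, ?_, ?_⟩ <;> rintro rfl <;> simp at hcard <;>
      exact absurd hcard (Finset.card_le_three.trans_lt (by norm_num)).ne
  obtain ⟨hab, hac, had, hbc, hbd, hcd⟩ := hne
  have ha : a ∈ A.lines := by simp [hA']
  have hb : b ∈ A.lines := by simp [hA']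
  have hc : c ∈ A.lines := by simp [hA']
  have hd : d ∈ A.lines := by simp [hA']
  refine ⟨fun h => ?_, fun h => ?_⟩
  · exact absurd (hcda.unique (h c hc d hd a ha hcd hac.symm had.symm)) (by decide)
  · exact absurd (habc.unique (h a ha b hb c hc hab hac hbc)) (by decide)

end SkewLines

open SkewLines
theorem mainTheorem4 :
    ∃ cPlus cMinus cPair : IsotopyClass 4,
      -- there are exactly three isotopy classes
      (cPlus ≠ cMinus ∧ cPlus ≠ cPair ∧ cMinus ≠ cPair) ∧
      (∀ A : Interlacing 4, A.isotopyClass = cPlus ∨ A.isotopyClass = cMinus ∨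
        A.isotopyClass = cPair) ∧
      -- they are the classes of `⟨+4⟩`, `⟨-4⟩` and `⟨⟨+2⟩, ⟨-2⟩⟩`
      ((∃ A : Interlacing 4, IsHyperboloidal 1 A) ∧
        ∀ A : Interlacing 4, IsHyperboloidal 1 A → A.isotopyClass = cPlus) ∧
      ((∃ A : Interlacing 4, IsHyperboloidal (-1) A) ∧
        ∀ A : Interlacing 4, IsHyperboloidal (-1) A → A.isotopyClass = cMinus) ∧
      ((∃ A : Interlacing 4, IsPairOfPairs 1 (-1) A) ∧
        ∀ A : Interlacing 4, IsPairOfPairs 1 (-1) A → A.isotopyClass = cPair) ∧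
      -- the first two are mirror images of each other, the third is its own mirror image
      (∀ (P : AffineSubspace ℝ Space) [Nonempty P], Module.finrank ℝ P.direction = 2 →
        ∀ A : Interlacing 4,
          (A.isotopyClass = cPlus → (A.mirror P).isotopyClass = cMinus) ∧
          (A.isotopyClass = cMinus → (A.mirror P).isotopyClass = cPlus) ∧
          (A.isotopyClass = cPair → (A.mirror P).isotopyClass = cPair)) ∧
      -- exactly the interlacings of the third class are amphicheiral
      (∀ A : Interlacing 4, Amphicheiral A ↔ A.isotopyClass = cPair) := by
  have hclass : ∀ A B : Interlacing 4, A.isotopyClass = B.isotopyClass ↔ Isotopic A B :=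
    fun A B => Quotient.eq (r := isotopySetoid 4)
  obtain ⟨A₁, hA₁⟩ := exists_isHyperboloidal (e := 1) (by norm_num)
  obtain ⟨A₂, hA₂⟩ := exists_isHyperboloidal (e := -1) (by norm_num)
  obtain ⟨A₃, hA₃⟩ := exists_isPairOfPairs
  rw [sign_one] at hA₁
  rw [show SignType.sign (-1 : ℝ) = -1 from sign_neg (by norm_num)] at hA₂
  -- The linking numbers of the triples determine the class.
  have h₁ : ∀ A : Interlacing 4, A.isotopyClass = A₁.isotopyClass ↔ A.IsUniform 1 := fun A =>
    (hclass _ _).trans ⟨fun h => (h.isUniform_iff 1).2 hA₁.2, fun h =>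
      isotopic_of_isUniform h hA₁.2⟩
  have h₂ : ∀ A : Interlacing 4, A.isotopyClass = A₂.isotopyClass ↔ A.IsUniform (-1) := fun A =>
    (hclass _ _).trans ⟨fun h => (h.isUniform_iff (-1)).2 hA₂.2, fun h =>
      isotopic_of_isUniform h hA₂.2⟩
  have h₃ : ∀ A : Interlacing 4, A.isotopyClass = A₃.isotopyClass ↔
      ¬ A.IsUniform 1 ∧ ¬ A.IsUniform (-1) := fun A =>
    (hclass _ _).trans ⟨fun h => by
      rw [h.isUniform_iff, h.isUniform_iff]; exact hA₃.not_isUniform, fun h =>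
      isotopic_of_not_isUniform h.1 h.2 hA₃.not_isUniform.1 hA₃.not_isUniform.2⟩
  have hexcl : ∀ A : Interlacing 4, A.IsUniform 1 → ¬ A.IsUniform (-1) := fun A =>
    not_isUniform_neg_one_of_isUniform_one
  refine ⟨A₁.isotopyClass, A₂.isotopyClass, A₃.isotopyClass, ⟨?_, ?_, ?_⟩, ?_,
    ⟨⟨A₁, hA₁⟩, fun A hA => (h₁ A).2 hA.2⟩, ⟨⟨A₂, hA₂⟩, fun A hA => (h₂ A).2 hA.2⟩,
    ⟨⟨A₃, hA₃⟩, fun A hA => (h₃ A).2 hA.not_isUniform⟩, ?_, ?_⟩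
  · exact fun h => hexcl _ ((h₁ A₁).1 rfl) ((h₂ A₁).1 h)
  · exact fun h => ((h₃ A₁).1 h).1 ((h₁ A₁).1 rfl)
  · exact fun h => ((h₃ A₂).1 h).2 ((h₂ A₂).1 rfl)
  · intro A
    rw [h₁, h₂, h₃]
    tauto
  · intro P _ hP A
    rw [h₁, h₂, h₃, h₁, h₂, h₃, Interlacing.isUniform_mirror_iff P hP,
      Interlacing.isUniform_mirror_iff P hP, neg_neg]
    exact ⟨id, id, And.symm⟩
  · intro A
    have hmirror : ∀ (P : AffineSubspace ℝ Space) [Nonempty P],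
        Module.finrank ℝ P.direction = 2 →
        (Isotopic A (A.mirror P) ↔ A.isotopyClass = A₃.isotopyClass) := by
      intro P _ hP
      have hm := fun ε => Interlacing.isUniform_mirror_iff (A := A) (ε := ε) P hP
      constructor
      · intro h
        have e := (h.isUniform_iff 1).trans (hm 1)
        exact (h₃ A).2 ⟨fun h' => hexcl A h' (e.1 h'), fun h' => hexcl A (e.2 h') h'⟩
      · intro h
        have h' := (h₃ A).1 h
        refine isotopic_of_not_isUniform h'.1 h'.2 ?_ ?_ <;> rw [hm]
        · exact h'.2
        · rw [neg_neg]; exact h'.1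
    constructor
    · rintro ⟨P, _, hP, h⟩
      exact (hmirror P hP).1 h
    · intro h
      let v : Space := EuclideanSpace.single 0 1
      have hv : v ≠ 0 := by simp [v]
      let P : AffineSubspace ℝ Space := AffineSubspace.mk' 0 (ℝ ∙ v)ᗮ
      have hne : Nonempty P := ⟨⟨0, AffineSubspace.self_mem_mk' _ _⟩⟩
      have hP : Module.finrank ℝ P.direction = 2 := by
        have : Fact (Module.finrank ℝ Space = 2 + 1) := ⟨by simp⟩
        rw [AffineSubspace.direction_mk']
        exact Submodule.finrank_orthogonal_span_singleton hv
      exact ⟨P, hne, hP, (hmirror P hP).2 h⟩
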